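/- Let $\mathbb{R}^n=\mathbb{R}^{n_1}\times\dots\times\mathbb{R}^{n_j}$ with $j\ge 1$, $n_l\ge 1$, $n=n_1+\dots+n_j$. For $\mathbf{s}\in\mathbb{R}^j$ let $\mathcal{H}^{\mathbf{s}}(\mathbb{R}^n)$ be the space of $u\in\mathcal{S}'(\mathbb{R}^n)$ with $$\|u\|_{\mathcal{H}^{\mathbf{s}}}=\big\|(1-\Delta_{\mathbb{R}^{n_1}})^{s_1/2}\otimes\dots\otimes(1-\Delta_{\mathbb{R}^{n_j}})^{s_j/2}u\big\|_{L^2}<\infty .$$ For $1\le p\le\infty$ let $\mathcal{K}_p^{\mathbf{s}}(\mathbb{R}^n)$ be the space of all $u\in\mathcal{D}'(\mathbb{R}^n)$ such that, for some $\chi\in C_0^\infty(\mathbb{R}^n)\setminus 0$, with $\tau_y\chi=\chi(\cdot-y)$, one has $u\,\tau_y\chi\in\mathcal{H}^{\mathbf{s}}$ for all $y$ and the function $y\mapsto\|u\,\tau_y\chi\|_{\mathcal{H}^{\mathbf{s}}}$ belongs to $L^p(\mathbb{R}^n)$. For $\chi\in C_0^\infty(\mathbb{R}^n)\setminus 0$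 put $\|u\|_{\mathbf{s},p,\chi}=\big(\int\|u\,\tau_y\chi\|_{\mathcal{H}^{\mathbf{s}}}^p\,dy\big)^{1/p}$ if $p<\infty$ and $\|u\|_{\mathbf{s},\infty,\chi}=\sup_y\|u\,\tau_y\chi\|_{\mathcal{H}^{\mathbf{s}}}$; also write $\mathcal{H}^{\mathbf{s}}_{\mathrm{ul}}=\mathcal{K}^{\mathbf{s}}_\infty$. The product of $S\in\mathcal{H}^{\mathbf{s}}$ and $T\in\mathcal{H}^{\mathbf{t}}$ is the limit in $\mathcal{S}'(\mathbb{R}^n)$ of $f_kg_k$, for any Schwartz functions $f_k\to S$ in $\mathcal{H}^{\mathbf{s}}$ and $g_k\to T$ in $\mathcal{H}^{\mathbf{t}}$, when this limit exists and is the same for all such sequences. The product of $u\in\mathcal{K}_p^{\mathbf{s}}$ and $v\in\mathcal{K}_q^{\mathbf{t}}$ is the distribution $uv$ such that $\varphi\psi\,(uv)$ is the product of $\varphi u\in\mathcal{H}^{\mathbf{s}}$ and $\psi v\in\mathcal{H}^{\mathbf{t}}$ for all $\varphi,\psi\in C_0^\infty(\mathbb{R}^n)$. **Proposition 3.8.**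 Let $\mathbf{s},\mathbf{t},\varepsilon,\sigma\in\mathbb{R}^j$ be such that for every $l\in\{1,\dots,j\}$ $$s_l+t_l>\tfrac{n_l}{2},\qquad 0<\varepsilon_l<s_l+t_l-\tfrac{n_l}{2},\qquad \sigma_l=\min\{s_l,\,t_l,\,s_l+t_l-\tfrac{n_l}{2}-\varepsilon_l\}.$$ Then there is a constant $C$, depending only on $\mathbf{s},\mathbf{t},\varepsilon$ and $(n_1,\dots,n_j)$, such that for all $p,q,r\in[1,\infty]$ with $\frac1p+\frac1q=\frac1r$ and all $u\in\mathcal{K}_p^{\mathbf{s}}(\mathbb{R}^n)$, $v\in\mathcal{K}_q^{\mathbf{t}}(\mathbb{R}^n)$ the product $uv$ exists and is unique, $uv\in\mathcal{K}_r^{\sigma}(\mathbb{R}^n)$, and $$\|uv\|_{\sigma,r,\chi^2}\le C\,\|u\|_{\mathbf{s},p,\chi}\,\|v\|_{\mathbf{t},q,\chi}\qquad\text{for every }\chi\in C_0^\infty(\mathbb{R}^n)\setminus 0 .$$ Moreover, if $s_l>n_l/2$ for every $l$ and $1\le p\le\infty$, then $\mathcal{K}_p^{\mathbf{s}}(\mathbb{R}^n)$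 is an ideal in $\mathcal{H}^{\mathbf{s}}_{\mathrm{ul}}(\mathbb{R}^n)$: it is a linear subspace of $\mathcal{D}'(\mathbb{R}^n)$ contained in $\mathcal{H}^{\mathbf{s}}_{\mathrm{ul}}(\mathbb{R}^n)$, and for all $u\in\mathcal{H}^{\mathbf{s}}_{\mathrm{ul}}(\mathbb{R}^n)$ and $v\in\mathcal{K}_p^{\mathbf{s}}(\mathbb{R}^n)$ the product $uv$ exists, is unique and belongs to $\mathcal{K}_p^{\mathbf{s}}(\mathbb{R}^n)$. -/

import Mathlib

open scoped SchwartzMap ENNReal NNReal Topology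

noncomputable section

namespace KatoSobolev

/-- `ℝⁿ = ℝ^{n₁} × ⋯ × ℝ^{n_j}` with `n = n₁ + ⋯ + n_j` and its Euclidean norm.  The pair `⟨l, k⟩`
indexes the `k`-th coordinate of the `l`-th block. -/
abbrev Space {j : ℕ} (n : Fin j → ℕ) : Type := EuclideanSpace ℝ (Σ l : Fin j, Fin (n l))

/-- Complex-valued test functions on `ℝⁿ`: the space `C₀^∞(ℝⁿ)`. -/
abbrev Test {j : ℕ} (n : Fin j → ℕ) : Type :=
  TestFunction (⊤ : TopologicalSpace.Opens (Space n)) ℂ ⊤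

/-- Complex-valued distributions on `ℝⁿ`: the space `D'(ℝⁿ)`.  Following Mathlib, a distribution is
a continuous real-linear map defined on real-valued test functions. -/
abbrev Distr {j : ℕ} (n : Fin j → ℕ) : Type :=
  Distribution (⊤ : TopologicalSpace.Opens (Space n)) ℂ ⊤

variable {j : ℕ} {n : Fin j → ℕ}

/-- The component of `x` in the factor `ℝ^{n_l}`. -/
def block (l : Fin j) : Space n →L[ℝ] EuclideanSpace ℝ (Fin (n l)) :=
  LinearMap.toContinuousLinearMap
    { toFun := fun x => WithLp.toLp 2 fun k => x ⟨l, k⟩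
      map_add' := fun _ _ => rfl
      map_smul' := fun _ _ => rfl }

/-! ### Sobolev spaces of multiple order -/

/-- The weight `⟨⟨ξ⟩⟩^s = ∏ₗ (1 + |ξₗ|²)^{sₗ/2}`. -/
def weight (s : Fin j → ℝ) (ξ : Space n) : ℝ :=
  ∏ l, (1 + ‖block l ξ‖ ^ 2) ^ (s l / 2)

theorem weight_hasTemperateGrowth (s : Fin j → ℝ) (c : ℝ) :
    Function.HasTemperateGrowth fun ξ : Space n => ((weight s (c • ξ) : ℝ) : ℂ) := by
  have key : ∀ t : Finset (Fin j), Function.HasTemperateGrowth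
      fun ξ : Space n => ∏ l ∈ t, (1 + ‖block l (c • ξ)‖ ^ 2) ^ (s l / 2) := by
    intro t
    induction t using Finset.induction_on with
    | empty => simp
    | insert l t hl ih =>
      simp only [Finset.prod_insert hl]
      have h1 : Function.HasTemperateGrowth
          fun ξ : Space n => (1 + ‖block l (c • ξ)‖ ^ 2) ^ (s l / 2) :=
        (Function.hasTemperateGrowth_one_add_norm_sq_rpow
          (H := EuclideanSpace ℝ (Fin (n l))) (s l / 2)).comp
          (c • (block l : Space n →L[ℝ] _)).hasTemperateGrowth |> fun h => by
            simpa [Function.comp_def] using h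
      exact h1.mul ih
  exact Complex.ofRealCLM.hasTemperateGrowth.comp (key Finset.univ)

/-- The operator `⟨⟨D⟩⟩^s = (1 - Δ_{ℝ^{n₁}})^{s₁/2} ⊗ ⋯ ⊗ (1 - Δ_{ℝ^{n_j}})^{s_j/2}` on tempered
distributions.  Mathlib's Fourier transform uses the kernel `exp(-2πi⟨x, ξ⟩)`, so that the symbol
of `D` is `2πξ`. -/
def bessel (s : Fin j → ℝ) : 𝓢'(Space n, ℂ) →L[ℂ] 𝓢'(Space n, ℂ) :=
  TemperedDistribution.fourierMultiplierCLM ℂ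
    fun ξ => ((weight s ((2 * Real.pi) • ξ) : ℝ) : ℂ)

/-- The norm `‖T‖_{H^s} = ‖⟨⟨D⟩⟩^s T‖_{L²}` of a tempered distribution, with the value `∞` exactly
when `⟨⟨D⟩⟩^s T` does not belong to `L²(ℝⁿ)`. -/
def hNorm (s : Fin j → ℝ) (T : 𝓢'(Space n, ℂ)) : ℝ≥0∞ :=
  ⨅ (f : MeasureTheory.Lp ℂ 2 (MeasureTheory.volume : MeasureTheory.Measure (Space n)))
    (_ : bessel s T = (f : 𝓢'(Space n, ℂ))), ‖f‖ₑ

/-- `T` belongs to `H^s(ℝⁿ)`. -/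
def MemH (s : Fin j → ℝ) (T : 𝓢'(Space n, ℂ)) : Prop :=
  ∃ f : MeasureTheory.Lp ℂ 2 (MeasureTheory.volume : MeasureTheory.Measure (Space n)),
    bessel s T = (f : 𝓢'(Space n, ℂ))

/-! ### Multiplication of distributions by test functions -/

/-- The translate `τ_y χ = χ(· - y)`. -/
def translate (y : Space n) (χ : Test n) : Test n where
  toFun x := χ (x - y)
  contDiff' := χ.contDiff.comp (contDiff_id.sub contDiff_const)
  hasCompactSupport' := by
    simpa [Function.comp_def, sub_eq_add_neg] using
      χ.hasCompactSupport.comp_homeomorph (Homeomorph.addRight (-y))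
  tsupport_subset' := fun _ _ => trivial

/-- The pointwise product of two test functions. -/
def testMul (φ ψ : Test n) : Test n where
  toFun x := φ x * ψ x
  contDiff' := φ.contDiff.mul ψ.contDiff
  hasCompactSupport' := φ.hasCompactSupport.mul_right
  tsupport_subset' := fun _ _ => trivial

/-- The support of a test function, as a bundled compact set. -/
def supp (φ : Test n) : TopologicalSpace.Compacts (Space n) :=
  ⟨tsupport φ, φ.hasCompactSupport⟩

theorem test_hasTemperateGrowth (φ : Test n) : Function.HasTemperateGrowth φ :=
  φ.hasCompactSupport.hasTemperateGrowth φ.contDiff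

/-- For a real-linear `c : ℂ → ℝ` (such as the real or the imaginary part) the map
`f ↦ c(φ f)`, from Schwartz functions to smooth functions with support in that of `φ`. -/
def cutLM (c : ℂ →L[ℝ] ℝ) (φ : Test n) :
    𝓢(Space n, ℂ) →ₗ[ℝ] ContDiffMapSupportedIn (Space n) ℝ ⊤ (supp φ) where
  toFun f :=
    { toFun := fun x => c (φ x * f x)
      contDiff' := c.contDiff.comp (φ.contDiff.mul (f.smooth ⊤))
      zero_on_compl' := fun x hx => by
        have : φ x = 0 := image_eq_zero_of_notMem_tsupport hx
        simp [this] }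
  map_add' f g := by
    ext x
    change c (φ x * (f x + g x)) = c (φ x * f x) + c (φ x * g x)
    rw [mul_add, map_add]
  map_smul' r f := by
    ext x
    change c (φ x * (r • f x)) = r • c (φ x * f x)
    rw [mul_smul_comm, map_smul]

theorem continuous_cutLM (c : ℂ →L[ℝ] ℝ) (φ : Test n) : Continuous (cutLM c φ) := by
  refine (ContDiffMapSupportedIn.withSeminorms ℝ (Space n) ℝ ⊤ (supp φ)).continuous_of_continuous_comp
    _ fun i => ?_
  let P : 𝓢(Space n, ℂ) →L[ℝ] 𝓢(Space n, ℝ) :=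
    (SchwartzMap.postcompCLM c).comp
      ((SchwartzMap.smulLeftCLM ℂ (φ : Space n → ℂ)).restrictScalars ℝ)
  have hP : ∀ f : 𝓢(Space n, ℂ), ∀ x, P f x = cutLM c φ f x := by
    intro f x
    simp [P, SchwartzMap.smulLeftCLM_apply_apply (test_hasTemperateGrowth φ)]
    rfl
  have hcont : Continuous ((SchwartzMap.seminorm ℝ 0 i).comp P.toLinearMap) :=
    ((schwartz_withSeminorms ℝ (Space n) ℝ).continuous_seminorm (0, i)).comp P.continuous
  refine Seminorm.continuous_of_le hcont fun f => ?_
  refine (ContDiffMapSupportedIn.seminorm_top_le_iff ℝ (apply_nonneg _ _) i _).2 fun x _ => ?_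
  have : (cutLM c φ f : Space n → ℝ) = P f := funext fun x => (hP f x).symm
  rw [this]
  exact SchwartzMap.norm_iteratedFDeriv_le_seminorm ℝ (P f) i x

/-- The map `f ↦ c(φ f)` as a continuous linear map into the real-valued test functions. -/
def cut (c : ℂ →L[ℝ] ℝ) (φ : Test n) :
    𝓢(Space n, ℂ) →L[ℝ] TestFunction (⊤ : TopologicalSpace.Opens (Space n)) ℝ ⊤ :=
  (TestFunction.ofSupportedInCLM ℝ (K := supp φ) (Set.subset_univ _)).comp ⟨cutLM c φ, continuous_cutLM c φ⟩

@[simp] theorem cut_apply (c : ℂ →L[ℝ] ℝ) (φ : Test n) (f : 𝓢(Space n, ℂ)) (x : Space n) :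
    cut c φ f x = c (φ x * f x) := rfl

/-- The product `φ u` of a distribution and a test function.  It has compact support, and is
regarded as the tempered distribution `f ↦ ⟨u, φ f⟩ = ⟨u, Re(φ f)⟩ + i ⟨u, Im(φ f)⟩`. -/
def mulTest (φ : Test n) (u : Distr n) : 𝓢'(Space n, ℂ) where
  toFun f := u (cut Complex.reCLM φ f) + Complex.I * u (cut Complex.imCLM φ f)
  map_add' f g := by simp only [map_add]; ring
  map_smul' a f := by
    have h1 : cut Complex.reCLM φ (a • f)
        = a.re • cut Complex.reCLM φ f - a.im • cut Complex.imCLM φ f := by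
      ext x; simp; ring
    have h2 : cut Complex.imCLM φ (a • f)
        = a.re • cut Complex.imCLM φ f + a.im • cut Complex.reCLM φ f := by
      ext x; simp; ring
    rw [h1, h2]
    simp only [map_add, map_sub, map_smul, Complex.real_smul, RingHom.id_apply, smul_eq_mul]
    conv_rhs => rw [← Complex.re_add_im a]
    linear_combination
      (-(a.im : ℂ) * u (cut Complex.imCLM φ f)) * Complex.I_mul_I
  cont := by
    have h (c : ℂ →L[ℝ] ℝ) : Continuous fun f => u (cut c φ f) :=
      u.continuous.comp (cut c φ).continuous
    exact (h _).add (continuous_const.mul (h _))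

/-! ### Kato-Sobolev spaces -/

/-- `u` belongs to `K_p^s(ℝⁿ)`: for some test function `χ ≠ 0` the products `u τ_y χ` are in `H^s`
and the function `y ↦ ‖u τ_y χ‖_{H^s}` belongs to `L^p(ℝⁿ)`. -/
def MemK (p : ℝ≥0∞) (s : Fin j → ℝ) (u : Distr n) : Prop :=
  ∃ χ : Test n, χ ≠ 0 ∧ (∀ y, MemH s (mulTest (translate y χ) u)) ∧
    MeasureTheory.MemLp (fun y => hNorm s (mulTest (translate y χ) u)) p MeasureTheory.volume

/-- The norm `‖u‖_{s,p,χ}`: `(∫ ‖u τ_y χ‖_{H^s}^p dy)^{1/p}` for `p < ∞`, and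
`sup_y ‖u τ_y χ‖_{H^s}` for `p = ∞`. -/
def kNorm (p : ℝ≥0∞) (s : Fin j → ℝ) (χ : Test n) (u : Distr n) : ℝ≥0∞ :=
  if p = ⊤ then ⨆ y, hNorm s (mulTest (translate y χ) u)
  else (∫⁻ y, hNorm s (mulTest (translate y χ) u) ^ p.toReal) ^ (1 / p.toReal)

/-! ### Products -/

/-- `W` is the product of `S ∈ H^s` and `T ∈ H^t`, in the sense of extension by continuity from
Schwartz functions: if `fₖ → S` in `H^s` and `gₖ → T` in `H^t` with Schwartz functions `fₖ`, `gₖ`,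
then the pointwise products `fₖ gₖ` converge to `W` as tempered distributions. -/
def IsProdH (s t : Fin j → ℝ) (S T W : 𝓢'(Space n, ℂ)) : Prop :=
  MemH s S ∧ MemH t T ∧
    ∀ f g : ℕ → 𝓢(Space n, ℂ),
      Filter.Tendsto (fun k => hNorm s (S - SchwartzMap.toTemperedDistributionCLM (Space n) ℂ MeasureTheory.volume (f k)))
        Filter.atTop (𝓝 0) →
      Filter.Tendsto (fun k => hNorm t (T - SchwartzMap.toTemperedDistributionCLM (Space n) ℂ MeasureTheory.volume (g k)))
        Filter.atTop (𝓝 0) →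
      ∀ h : 𝓢(Space n, ℂ),
        Filter.Tendsto (fun k => ∫ x, f k x * g k x * h x) Filter.atTop (𝓝 (W h))

/-- The distribution `w` is the product `u v`, where `u` is locally in `H^s` and `v` is locally in
`H^t`: for all test functions `φ`, `ψ`, `(φ ψ) w` is the product of `φ u ∈ H^s` and
`ψ v ∈ H^t`. -/
def IsProd (s t : Fin j → ℝ) (u v w : Distr n) : Prop :=
  ∀ φ ψ : Test n,
    IsProdH s t (mulTest φ u) (mulTest ψ v) (mulTest (testMul φ ψ) w)

end KatoSobolev

end

/-!
Put `⟨⟨ξ⟩⟩^s = ∏ₗ ⟨ξₗ⟩^{sₗ}`. On the Fourier side the product of `f ∈ H^s` and `g ∈ H^t`, measured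
in `H^σ`, has the kernel `k(ξ, η) = ⟨⟨ξ⟩⟩^σ ⟨⟨η⟩⟩^{-s} ⟨⟨ξ - η⟩⟩^{-t}`.  The choice of `σ` gives,
in each block, `k² ≤ C (⟨η⟩^{-2m} + ⟨ξ - η⟩^{-2m})` with `m = n/2 + ε`
(`rpow_kernel`, `weight_add_sq_le`): if `s` or `t` is negative, this is Peetre's inequality, and
otherwise `σ ≥ 0` and `⟨ξ⟩ ≤ 2 max(⟨η⟩, ⟨ξ - η⟩)`. Hence `∫ k(ξ, η)² dη` is bounded uniformly in
`ξ` (`exists_lintegral_decay_le`), and the Cauchy-Schwarz inequality and Tonelli's theorem give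
`‖f g‖_σ ≤ C ‖f‖_s ‖g‖_t` for Schwartz functions
(`exists_hNorm_schwartzMul_le`).  Schwartz functions are dense in `H^s`, so the product extends to
`H^s × H^t → H^σ` by continuity (`exists_isProdH`).  For large `t` one has `σ = s`, so that
multiplication by a Schwartz function `φ` is bounded on `H^s` with a norm at most `C ‖φ‖_t`
(`exists_hNorm_schwartzSmul_le`); translation of `φ` does not change this bound.

Products of `φ u` and `ψ v` are compatible for different test functions `φ`, `ψ`, and glue to a
distribution `u v` (`exists_isProd`).  Applied to `φ = ψ = τ_y χ`, the estimate in `H^σ` holds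
pointwise in `y`, and Hölder's inequality in `y` gives the estimate of `u v`
(`exists_product`). Here one needs that `y ↦ ‖u τ_y χ‖` is continuous (`LocH.continuous_localNorm`)
and that membership in `K_p^s` does not depend on the localizing function (`MemK.memLp`): each test
function is a finite sum of multiples of translates of a given one. Finally `K_p^s ⊆ K_∞^s`, since
`‖u τ_y χ₁‖` is bounded by `C ‖u τ_{y + z} χ₂‖` for all `|z| ≤ 1` if `χ₂ = 1` on the closed unit
neighbourhood of `supp χ₁`, so that it can be averaged over `z` (`MemK.top`).
-/

noncomputable section

namespace KatoSobolev

variable {j : ℕ} {n : Fin j → ℕ}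

/-! ### Kernel estimates on the Fourier side -/

/-- The case of a negative order `s`: Peetre's inequality moves `A ^ s` to `D` at the cost of a
power of `B`. -/
theorem rpow_kernel_of_neg {A B D s t σ m : ℝ} (hA : 1 ≤ A) (hB : 1 ≤ B) (hD : 1 ≤ D)
    (hAD : A ≤ 2 * (D * B)) (hs : s ≤ 0) (hσ : σ ≤ s) (hm : m ≤ s + t) :
    D ^ σ ≤ 4 ^ (|s| + |t|) * (A ^ s * B ^ t * (A ^ (-m) + B ^ (-m))) := by
  have hA0 : 0 < A := by linarith
  have hB0 : 0 < B := by linarith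
  have hD0 : 0 < D := by linarith
  have h1 : D ^ σ ≤ D ^ s := Real.rpow_le_rpow_of_exponent_le hD hσ
  have h2 : (2 * (D * B)) ^ s ≤ A ^ s := Real.rpow_le_rpow_of_nonpos hA0 hAD hs
  have h3 : D ^ s ≤ 2 ^ (-s) * (A ^ s * B ^ (-s)) := by
    rw [Real.mul_rpow (by norm_num) (by positivity), Real.mul_rpow hD0.le hB0.le] at h2
    calc D ^ s = 2 ^ (-s) * ((2 ^ s * (D ^ s * B ^ s)) * B ^ (-s)) := by
          rw [Real.rpow_neg (by norm_num), Real.rpow_neg hB0.le]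
          have : (2 : ℝ) ^ s ≠ 0 := (Real.rpow_pos_of_pos (by norm_num) s).ne'
          have : B ^ s ≠ 0 := (Real.rpow_pos_of_pos hB0 s).ne'
          field_simp
      _ ≤ _ := by gcongr
  have h4 : B ^ (-s) ≤ B ^ t * (A ^ (-m) + B ^ (-m)) := by
    calc B ^ (-s) ≤ B ^ (t + -m) := Real.rpow_le_rpow_of_exponent_le hB (by linarith)
      _ = B ^ t * B ^ (-m) := Real.rpow_add hB0 _ _
      _ ≤ _ := by
        gcongr
        have := Real.rpow_nonneg hA0.le (-m)
        linarith
  have h5 : (2 : ℝ) ^ (-s) ≤ 4 ^ (|s| + |t|) := by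
    calc (2 : ℝ) ^ (-s) ≤ 4 ^ (-s) := Real.rpow_le_rpow (by norm_num) (by norm_num) (by linarith)
      _ ≤ _ := Real.rpow_le_rpow_of_exponent_le (by norm_num)
        (by have := neg_le_abs s; have := abs_nonneg t; linarith)
  calc D ^ σ ≤ 2 ^ (-s) * (A ^ s * B ^ (-s)) := h1.trans h3
    _ ≤ 4 ^ (|s| + |t|) * (A ^ s * (B ^ t * (A ^ (-m) + B ^ (-m)))) := by gcongr
    _ = _ := by ring

/-- The case of nonnegative orders, if `D ≤ 4 A`. -/
theorem rpow_kernel_of_nonneg {A B D s t σ m : ℝ} (hA : 1 ≤ A) (hB : 1 ≤ B) (hD : 1 ≤ D)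
    (hDA : D ≤ 4 * A) (ht : 0 ≤ t) (hσ0 : 0 ≤ σ) (hσ : σ ≤ s) (hm : σ + m ≤ s + t) :
    D ^ σ ≤ 4 ^ (|s| + |t|) * (A ^ s * B ^ t * (A ^ (-m) + B ^ (-m))) := by
  have hA0 : 0 < A := by linarith
  have hB0 : 0 < B := by linarith
  have h1 : D ^ σ ≤ 4 ^ σ * A ^ σ := by
    rw [← Real.mul_rpow (by norm_num) hA0.le]
    exact Real.rpow_le_rpow (by linarith) hDA hσ0
  have h2 : (4 : ℝ) ^ σ ≤ 4 ^ (|s| + |t|) := Real.rpow_le_rpow_of_exponent_le (by norm_num)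
    (by have := le_abs_self s; have := abs_nonneg t; linarith)
  have h3 : A ^ (σ - s) ≤ B ^ t * (A ^ (-m) + B ^ (-m)) := by
    have hAm := Real.rpow_nonneg hA0.le (-m)
    have hBm := Real.rpow_nonneg hB0.le (-m)
    rcases le_total A B with hAB | hAB
    · calc A ^ (σ - s) ≤ A ^ (t + -m) := Real.rpow_le_rpow_of_exponent_le hA (by linarith)
        _ = A ^ t * A ^ (-m) := Real.rpow_add hA0 _ _
        _ ≤ B ^ t * (A ^ (-m) + B ^ (-m)) := by
          gcongr
          linarith
    · calc A ^ (σ - s) ≤ B ^ (σ - s) := Real.rpow_le_rpow_of_nonpos hB0 hAB (by linarith)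
        _ ≤ B ^ (t + -m) := Real.rpow_le_rpow_of_exponent_le hB (by linarith)
        _ = B ^ t * B ^ (-m) := Real.rpow_add hB0 _ _
        _ ≤ B ^ t * (A ^ (-m) + B ^ (-m)) := by
          gcongr
          linarith
  calc D ^ σ ≤ 4 ^ σ * A ^ σ := h1
    _ = 4 ^ σ * (A ^ s * A ^ (σ - s)) := by rw [← Real.rpow_add hA0]; ring_nf
    _ ≤ 4 ^ (|s| + |t|) * (A ^ s * (B ^ t * (A ^ (-m) + B ^ (-m)))) := by gcongr
    _ = _ := by ring

/-- The kernel estimate in one block, for `A = 1 + |x|²`, `B = 1 + |y|²` and `D = 1 + |x + y|²`.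
Each term on the right involves, besides the weights, a function of a single one of the variables
`x`, `y`. -/
theorem rpow_kernel {A B D s t σ d ε : ℝ} (hA : 1 ≤ A) (hB : 1 ≤ B) (hD : 1 ≤ D)
    (hDAB : D ≤ 2 * A + 2 * B) (hAD : A ≤ 2 * (D * B)) (hBD : B ≤ 2 * (D * A))
    (hε' : ε < s + t - d)
    (hσ : σ = min s (min t (s + t - d - ε))) :
    D ^ σ ≤ 4 ^ (|s| + |t|) * (A ^ s * B ^ t * (A ^ (-(d + ε)) + B ^ (-(d + ε)))) := by
  have hσs : σ ≤ s := hσ ▸ min_le_left _ _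
  have hσt : σ ≤ t := hσ ▸ (min_le_right _ _).trans (min_le_left _ _)
  have hσm : σ ≤ s + t - d - ε := hσ ▸ (min_le_right _ _).trans (min_le_right _ _)
  have swap : 4 ^ (|s| + |t|) * (A ^ s * B ^ t * (A ^ (-(d + ε)) + B ^ (-(d + ε))))
      = 4 ^ (|t| + |s|) * (B ^ t * A ^ s * (B ^ (-(d + ε)) + A ^ (-(d + ε)))) := by
    rw [add_comm |s|]; ring
  rcases le_total s 0 with hs | hs
  · exact rpow_kernel_of_neg hA hB hD hAD hs hσs (by linarith)
  rcases le_total t 0 with ht | ht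
  · rw [swap]
    exact rpow_kernel_of_neg hB hA hD hBD ht hσt (by linarith)
  have hσ0 : 0 ≤ σ := hσ ▸ le_min hs (le_min ht (by linarith))
  rcases le_total A B with hAB | hAB
  · rw [swap]
    exact rpow_kernel_of_nonneg hB hA hD (by linarith) hs hσ0 hσt (by linarith)
  · exact rpow_kernel_of_nonneg hA hB hD (by linarith) ht hσ0 hσs (by linarith)

theorem weight_pos (s : Fin j → ℝ) (ξ : Space n) : 0 < weight s ξ :=
  Finset.prod_pos fun _ _ => by positivity

theorem weight_sq (s : Fin j → ℝ) (ξ : Space n) :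
    weight s ξ ^ 2 = ∏ l, (1 + ‖block l ξ‖ ^ 2) ^ s l := by
  rw [weight, ← Finset.prod_pow]
  refine Finset.prod_congr rfl fun l _ => ?_
  rw [← Real.rpow_natCast, ← Real.rpow_mul (by positivity)]
  simp

theorem weight_mul_weight_neg (s : Fin j → ℝ) (ξ : Space n) :
    weight s ξ * weight (-s) ξ = 1 := by
  rw [weight, weight, ← Finset.prod_mul_distrib]
  refine Finset.prod_eq_one fun l _ => ?_
  rw [← Real.rpow_add (by positivity)]
  simp [neg_div]

/-- The kernel `∏ₗ (⟨xₗ⟩^{-2mₗ} + ⟨yₗ⟩^{-2mₗ})`.  With `x = ξ - η` and `y = η` it controls the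
square of the kernel `⟨⟨ξ⟩⟩^σ ⟨⟨ξ - η⟩⟩^{-s} ⟨⟨η⟩⟩^{-t}` of a product on the Fourier side. -/
def decay (m : Fin j → ℝ) (x y : Space n) : ℝ :=
  ∏ l, ((1 + ‖block l x‖ ^ 2) ^ (-m l) + (1 + ‖block l y‖ ^ 2) ^ (-m l))

theorem decay_nonneg (m : Fin j → ℝ) (x y : Space n) : 0 ≤ decay m x y :=
  Finset.prod_nonneg fun _ _ => by positivity

theorem decay_comm (m : Fin j → ℝ) (x y : Space n) : decay m x y = decay m y x :=
  Finset.prod_congr rfl fun _ _ => add_comm _ _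

/-- The kernel estimate for the product weights, obtained by multiplying the estimates of the
blocks. -/
theorem weight_add_sq_le {s t ε σ : Fin j → ℝ}
    (hε : ∀ l, 0 < ε l ∧ ε l < s l + t l - (n l : ℝ) / 2)
    (hσ : ∀ l, σ l = min (s l) (min (t l) (s l + t l - (n l : ℝ) / 2 - ε l))) (x y : Space n) :
    weight σ (x + y) ^ 2 ≤ (∏ l, 4 ^ (|s l| + |t l|)) *
      (weight s x ^ 2 * weight t y ^ 2 * decay (fun l => (n l : ℝ) / 2 + ε l) x y) := by
  simp only [weight_sq, decay, ← Finset.prod_mul_distrib]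
  refine Finset.prod_le_prod (fun l _ => by positivity) fun l _ => ?_
  set a := block l x
  set b := block l y
  have hab : block l (x + y) = a + b := map_add _ _ _
  rw [hab]
  have h1 : ‖a + b‖ ≤ ‖a‖ + ‖b‖ := norm_add_le a b
  have h2 : ‖a‖ ≤ ‖a + b‖ + ‖b‖ := by simpa using norm_sub_le (a + b) b
  have h3 : ‖b‖ ≤ ‖a + b‖ + ‖a‖ := by simpa using norm_sub_le (a + b) a
  have ha := norm_nonneg a
  have hb := norm_nonneg b
  have hc := norm_nonneg (a + b)
  refine rpow_kernel (by nlinarith) (by nlinarith) (by nlinarith) ?_ ?_ ?_ (hε l).2 (hσ l)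
  · nlinarith [sq_nonneg (‖a‖ - ‖b‖)]
  · nlinarith [sq_nonneg (‖a + b‖ - ‖b‖), mul_nonneg (sq_nonneg ‖a + b‖) (sq_nonneg ‖b‖)]
  · nlinarith [sq_nonneg (‖a + b‖ - ‖a‖), mul_nonneg (sq_nonneg ‖a + b‖) (sq_nonneg ‖a‖)]

/-- A block bracket to a negative power is bounded by a product of one-dimensional brackets. -/
theorem block_bracket_le {m : Fin j → ℝ} (hn : ∀ l, 0 < n l) (hm : ∀ l, 0 ≤ m l) {c : ℝ}
    (hc : 1 ≤ c) (l : Fin j) (x : Space n) :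
    (1 + ‖block l (c • x)‖ ^ 2) ^ (-m l) ≤ ∏ k, (1 + x ⟨l, k⟩ ^ 2) ^ (-(m l / n l)) := by
  have hn' : (n l : ℝ) ≠ 0 := by exact_mod_cast (hn l).ne'
  have key (k : Fin (n l)) : 1 + x ⟨l, k⟩ ^ 2 ≤ 1 + ‖block l (c • x)‖ ^ 2 := by
    have h1 : ‖x ⟨l, k⟩‖ ≤ ‖block l x‖ := PiLp.norm_apply_le (block l x) k
    rw [Real.norm_eq_abs] at h1
    have h2 : ‖block l x‖ ≤ ‖block l (c • x)‖ := by
      rw [map_smul, norm_smul, Real.norm_of_nonneg (by linarith)]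
      exact le_mul_of_one_le_left (norm_nonneg _) hc
    have := pow_le_pow_left₀ (abs_nonneg _) (h1.trans h2) 2
    rw [sq_abs] at this
    linarith
  calc (1 + ‖block l (c • x)‖ ^ 2) ^ (-m l)
      = ∏ _k : Fin (n l), (1 + ‖block l (c • x)‖ ^ 2) ^ (-(m l / n l)) := by
        rw [Finset.prod_const, Finset.card_univ, Fintype.card_fin, ← Real.rpow_natCast _ (n l),
          ← Real.rpow_mul (by positivity)]
        congr 1
        field_simp
    _ ≤ _ := Finset.prod_le_prod (fun k _ => by positivity) fun k _ =>
        Real.rpow_le_rpow_of_nonpos (by positivity) (key k)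
          (neg_nonpos.2 (div_nonneg (hm l) (Nat.cast_nonneg _)))

open MeasureTheory Filter FourierTransform

/-- The kernel is integrable in `η`, with a bound that does not depend on `ξ`. -/
theorem exists_lintegral_decay_le {m : Fin j → ℝ} (hn : ∀ l, 0 < n l)
    (hm : ∀ l, (n l : ℝ) / 2 < m l) {c : ℝ} (hc : 1 ≤ c) :
    ∃ C : ℝ≥0, ∀ ξ : Space n,
      ∫⁻ η, ENNReal.ofReal (decay m (c • (ξ - η)) (c • η)) ≤ C := by
  have hm0 (l : Fin j) : 0 ≤ m l := by
    have := hm l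
    have : (0 : ℝ) ≤ n l := Nat.cast_nonneg _
    linarith
  -- the one-dimensional factors; the exponent `mₗ / nₗ` exceeds `1 / 2`, so they are integrable
  let φ (i : Σ l : Fin j, Fin (n l)) (x : ℝ) : ℝ := (1 + x ^ 2) ^ (-(m i.1 / n i.1))
  have hφ0 (i) (x) : 0 ≤ φ i x := by positivity
  have hφ (i) : Integrable (φ i) := by
    have hn' : (0 : ℝ) < n i.1 := by exact_mod_cast hn i.1
    have := integrable_rpow_neg_one_add_norm_sq (E := ℝ) (μ := volume)
      (r := 2 * (m i.1 / n i.1)) (by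
        have h : (1 : ℝ) / 2 < m i.1 / n i.1 := by
          rw [lt_div_iff₀ hn']
          linarith [hm i.1]
        simp
        linarith)
    refine this.congr (Filter.Eventually.of_forall fun x => ?_)
    simp only [φ, Real.norm_eq_abs, sq_abs]
    congr 1
    ring
  let I : ℝ≥0 := ∏ i, (∫ x, φ i x).toNNReal
  refine ⟨∑ _S ∈ (Finset.univ : Finset (Fin j)).powerset, I, fun ξ => ?_⟩
  -- expanding the product over the blocks, `S` collects the blocks that contribute `ξ - η`
  let ψ (S : Finset (Fin j)) (i : Σ l : Fin j, Fin (n l)) (x : ℝ) : ℝ :=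
    if i.1 ∈ S then φ i (ξ i - x) else φ i x
  have hψ0 (S i x) : 0 ≤ ψ S i x := by
    simp only [ψ]; split_ifs <;> exact hφ0 _ _
  have hψ (S i) : Integrable (ψ S i) := by
    by_cases h : i.1 ∈ S
    · simpa only [ψ, if_pos h] using (hφ i).comp_sub_left (ξ i)
    · simpa only [ψ, if_neg h] using hφ i
  have hψc (S i) : Continuous (ψ S i) := by
    have hφc : Continuous (φ i) := by
      refine Continuous.rpow_const (by fun_prop) fun x => Or.inl (by positivity)
    simp only [ψ]
    split_ifs
    · exact hφc.comp (by fun_prop)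
    · exact hφc
  have hψI (S i) : ∫ x, ψ S i x = ∫ x, φ i x := by
    by_cases h : i.1 ∈ S
    · simpa only [ψ, if_pos h] using integral_sub_left_eq_self (φ i) volume (ξ i)
    · simp only [ψ, if_neg h]
  have hle (η : Space n) : decay m (c • (ξ - η)) (c • η) ≤
      ∑ S ∈ (Finset.univ : Finset (Fin j)).powerset, ∏ i, ψ S i (η i) := by
    calc decay m (c • (ξ - η)) (c • η)
        ≤ ∏ l, ((∏ k, φ ⟨l, k⟩ ((ξ - η) ⟨l, k⟩)) + ∏ k, φ ⟨l, k⟩ (η ⟨l, k⟩)) := by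
          refine Finset.prod_le_prod (fun l _ => by positivity) fun l _ => ?_
          exact add_le_add (block_bracket_le hn hm0 hc l _) (block_bracket_le hn hm0 hc l _)
      _ = _ := by
          rw [Finset.prod_add]
          refine Finset.sum_congr rfl fun S hS => ?_
          rw [Fintype.prod_sigma, ← Finset.prod_sdiff (Finset.subset_univ S), mul_comm]
          congr 1
          · refine Finset.prod_congr rfl fun l hl => ?_
            simp [ψ, (Finset.mem_sdiff.1 hl).2]
          · refine Finset.prod_congr rfl fun l hl => ?_
            simp [ψ, hl]
  have hprod (S) : ∫⁻ η : Space n, ENNReal.ofReal (∏ i, ψ S i (η i)) = I := by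
    have e := (EuclideanSpace.volume_preserving_symm_measurableEquiv_toLp
      (Σ l : Fin j, Fin (n l)))
    have h1 : ∫⁻ η : Space n, ENNReal.ofReal (∏ i, ψ S i (η i)) =
        ∫⁻ x : (Σ l : Fin j, Fin (n l)) → ℝ, ENNReal.ofReal (∏ i, ψ S i (x i)) := by
      rw [← e.lintegral_comp_emb (MeasurableEquiv.measurableEmbedding _)]
      rfl
    rw [h1, volume_pi, ← ofReal_integral_eq_lintegral_ofReal (Integrable.fintype_prod (hψ S))
      (Filter.Eventually.of_forall fun x => Finset.prod_nonneg fun i _ => hψ0 S i _),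
      integral_fintype_prod_eq_prod]
    simp only [hψI, I]
    rw [ENNReal.ofReal, Real.toNNReal_prod_of_nonneg fun i _ => integral_nonneg (hφ0 i)]
  calc ∫⁻ η, ENNReal.ofReal (decay m (c • (ξ - η)) (c • η))
      ≤ ∫⁻ η : Space n, ∑ S ∈ (Finset.univ : Finset (Fin j)).powerset,
          ENNReal.ofReal (∏ i, ψ S i (η i)) := by
        refine lintegral_mono fun η => ?_
        rw [← ENNReal.ofReal_sum_of_nonneg fun S _ => Finset.prod_nonneg fun i _ => hψ0 S i _]
        exact ENNReal.ofReal_le_ofReal (hle η)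
    _ = ∑ S ∈ (Finset.univ : Finset (Fin j)).powerset,
          ∫⁻ η : Space n, ENNReal.ofReal (∏ i, ψ S i (η i)) := by
        refine lintegral_finsetSum' _ fun S _ => ?_
        refine (ENNReal.continuous_ofReal.comp (continuous_finsetProd _ fun i _ => ?_)).aemeasurable
        exact (hψc S i).comp (by fun_prop)
    _ ≤ _ := by
        simp only [hprod]
        push_cast
        rfl

/-! ### Sobolev norms of tempered distributions -/

/-- The tempered distribution defined by a Schwartz function. -/
abbrev ofSchwartz : 𝓢(Space n, ℂ) →L[ℂ] 𝓢'(Space n, ℂ) :=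
  SchwartzMap.toTemperedDistributionCLM (Space n) ℂ volume

theorem ofSchwartz_apply (f h : 𝓢(Space n, ℂ)) : ofSchwartz f h = ∫ x, h x * f x :=
  SchwartzMap.toTemperedDistributionCLM_apply_apply volume f h

/-- The symbol `⟨⟨2πξ⟩⟩^s` of `⟨⟨D⟩⟩^s`. -/
def symbol (s : Fin j → ℝ) (ξ : Space n) : ℂ := ((weight s ((2 * Real.pi) • ξ) : ℝ) : ℂ)

theorem symbol_hasTemperateGrowth (s : Fin j → ℝ) :
    Function.HasTemperateGrowth (symbol s : Space n → ℂ) :=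
  weight_hasTemperateGrowth s (2 * Real.pi)

theorem symbol_mul_symbol_neg (s : Fin j → ℝ) :
    (symbol s : Space n → ℂ) * symbol (-s) = fun _ => 1 := by
  ext ξ
  simp only [Pi.mul_apply, symbol, ← Complex.ofReal_mul, weight_mul_weight_neg, Complex.ofReal_one]

/-- The operator `⟨⟨D⟩⟩^s` on Schwartz functions. -/
def besselS (s : Fin j → ℝ) : 𝓢(Space n, ℂ) →L[ℂ] 𝓢(Space n, ℂ) :=
  SchwartzMap.fourierMultiplierCLM ℂ (symbol s)

theorem bessel_ofSchwartz (s : Fin j → ℝ) (f : 𝓢(Space n, ℂ)) :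
    bessel s (ofSchwartz f) = ofSchwartz (besselS s f) :=
  TemperedDistribution.fourierMultiplierCLM_toTemperedDistributionCLM_eq
    (symbol_hasTemperateGrowth s) f

theorem bessel_neg_bessel (s : Fin j → ℝ) (T : 𝓢'(Space n, ℂ)) :
    bessel (-s) (bessel s T) = T := by
  refine (TemperedDistribution.fourierMultiplierCLM_fourierMultiplierCLM_apply
    (symbol_hasTemperateGrowth s) (symbol_hasTemperateGrowth (-s)) T).trans ?_
  rw [symbol_mul_symbol_neg]
  simp

theorem bessel_bessel_neg (s : Fin j → ℝ) (T : 𝓢'(Space n, ℂ)) :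
    bessel s (bessel (-s) T) = T := by
  simpa using bessel_neg_bessel (-s) T

theorem fourier_besselS (s : Fin j → ℝ) (f : 𝓢(Space n, ℂ)) (ξ : Space n) :
    𝓕 (besselS s f) ξ = symbol s ξ * 𝓕 f ξ := by
  simp [besselS, SchwartzMap.fourierMultiplierCLM_apply, symbol_hasTemperateGrowth s]

theorem toTemperedDistribution_injective :
    Function.Injective (fun f : Lp ℂ 2 (volume : Measure (Space n)) => (f : 𝓢'(Space n, ℂ))) :=
  LinearMap.ker_eq_bot.1
    (Lp.ker_toTemperedDistributionCLM_eq_bot (E := Space n) (F := ℂ) (p := 2) (μ := volume))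

theorem hNorm_eq {s : Fin j → ℝ} {T : 𝓢'(Space n, ℂ)}
    {f : Lp ℂ 2 (volume : Measure (Space n))} (h : bessel s T = (f : 𝓢'(Space n, ℂ))) :
    hNorm s T = ‖f‖ₑ := by
  refine le_antisymm (iInf₂_le f h) (le_iInf₂ fun g hg => ?_)
  rw [toTemperedDistribution_injective (h.symm.trans hg)]

theorem hNorm_eq_top {s : Fin j → ℝ} {T : 𝓢'(Space n, ℂ)} (h : ¬ MemH s T) : hNorm s T = ⊤ :=
  iInf₂_eq_top.2 fun f hf => (h ⟨f, hf⟩).elim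

theorem memH_iff {s : Fin j → ℝ} {T : 𝓢'(Space n, ℂ)} : MemH s T ↔ hNorm s T < ⊤ := by
  refine ⟨fun ⟨f, hf⟩ => hNorm_eq hf ▸ enorm_lt_top, fun h => ?_⟩
  by_contra h'
  exact h.ne (hNorm_eq_top h')

theorem hNorm_add_le (s : Fin j → ℝ) (S T : 𝓢'(Space n, ℂ)) :
    hNorm s (S + T) ≤ hNorm s S + hNorm s T := by
  by_cases hS : MemH s S
  · by_cases hT : MemH s T
    · obtain ⟨f, hf⟩ := hS
      obtain ⟨g, hg⟩ := hT
      have : bessel s (S + T) =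
          ((f + g : Lp ℂ 2 (volume : Measure (Space n))) : 𝓢'(Space n, ℂ)) := by
        rw [map_add, hf, hg]
        exact (map_add (Lp.toTemperedDistributionCLM ℂ volume 2) f g).symm
      rw [hNorm_eq hf, hNorm_eq hg, hNorm_eq this]
      exact enorm_add_le f g
    · simp [hNorm_eq_top hT]
  · simp [hNorm_eq_top hS]

theorem hNorm_zero (s : Fin j → ℝ) : hNorm s (0 : 𝓢'(Space n, ℂ)) = 0 := by
  have : bessel s (0 : 𝓢'(Space n, ℂ)) =
      ((0 : Lp ℂ 2 (volume : Measure (Space n))) : 𝓢'(Space n, ℂ)) := by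
    rw [map_zero]
    exact (map_zero (Lp.toTemperedDistributionCLM ℂ volume 2)).symm
  rw [hNorm_eq this, enorm_zero]

theorem hNorm_smul_le (s : Fin j → ℝ) (a : ℂ) (T : 𝓢'(Space n, ℂ)) :
    hNorm s (a • T) ≤ ‖a‖ₑ * hNorm s T := by
  by_cases hT : MemH s T
  · obtain ⟨f, hf⟩ := hT
    have : bessel s (a • T) = ((a • f : Lp ℂ 2 (volume : Measure (Space n))) : 𝓢'(Space n, ℂ)) := by
      rw [map_smul, hf]
      exact (map_smul (Lp.toTemperedDistributionCLM ℂ volume 2) a f).symm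
    rw [hNorm_eq hf, hNorm_eq this, enorm_smul]
  · rcases eq_or_ne a 0 with rfl | ha
    · rw [zero_smul ℂ T, hNorm_zero]
      exact zero_le
    · rw [hNorm_eq_top hT, ENNReal.mul_top (by simpa using ha)]
      exact le_top

theorem hNorm_neg (s : Fin j → ℝ) (T : 𝓢'(Space n, ℂ)) : hNorm s (-T) = hNorm s T := by
  refine le_antisymm ?_ ?_
  · simpa [neg_one_smul ℂ T] using hNorm_smul_le s (-1) T
  · simpa [neg_one_smul ℂ (-T)] using hNorm_smul_le s (-1) (-T)

theorem hNorm_sub_comm (s : Fin j → ℝ) (S T : 𝓢'(Space n, ℂ)) :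
    hNorm s (S - T) = hNorm s (T - S) := by
  rw [← hNorm_neg, neg_sub]

theorem hNorm_sub_le (s : Fin j → ℝ) (S T R : 𝓢'(Space n, ℂ)) :
    hNorm s (S - R) ≤ hNorm s (S - T) + hNorm s (T - R) := by
  simpa using hNorm_add_le s (S - T) (T - R)

theorem hNorm_sum_le {ι : Type*} (s : Fin j → ℝ) (I : Finset ι) (T : ι → 𝓢'(Space n, ℂ)) :
    hNorm s (∑ i ∈ I, T i) ≤ ∑ i ∈ I, hNorm s (T i) := by
  classical
  induction I using Finset.induction_on with
  | empty => simp [hNorm_zero]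
  | insert i I hi ih =>
    rw [Finset.sum_insert hi, Finset.sum_insert hi]
    exact (hNorm_add_le s _ _).trans (by gcongr)

theorem hNorm_ofSchwartz (s : Fin j → ℝ) (f : 𝓢(Space n, ℂ)) :
    hNorm s (ofSchwartz f) = ‖(besselS s f).toLp 2 volume‖ₑ :=
  hNorm_eq ((bessel_ofSchwartz s f).trans (Lp.toTemperedDistribution_toLp_eq _).symm)

theorem memH_ofSchwartz (s : Fin j → ℝ) (f : 𝓢(Space n, ℂ)) : MemH s (ofSchwartz f) :=
  memH_iff.2 (hNorm_ofSchwartz s f ▸ enorm_lt_top)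

theorem enorm_symbol (s : Fin j → ℝ) (ξ : Space n) :
    ‖symbol s ξ‖ₑ = ENNReal.ofReal (weight s ((2 * Real.pi) • ξ)) := by
  rw [symbol, ← ofReal_norm, Complex.norm_real, Real.norm_of_nonneg (weight_pos _ _).le]

/-- Plancherel's theorem. -/
theorem hNorm_ofSchwartz_sq (s : Fin j → ℝ) (f : 𝓢(Space n, ℂ)) :
    hNorm s (ofSchwartz f) ^ 2 = ∫⁻ ξ, (‖symbol s ξ‖ₑ * ‖𝓕 f ξ‖ₑ) ^ 2 := by
  have h1 : ‖(besselS s f).toLp 2 volume‖ₑ =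
      eLpNorm (𝓕 (besselS s f) : 𝓢(Space n, ℂ)) 2 volume := by
    rw [← ofReal_norm, ← SchwartzMap.norm_fourier_toL2_eq, ofReal_norm,
      Lp.enorm_def]
    exact eLpNorm_congr_ae (SchwartzMap.coeFn_toLp _ _ _)
  have h2 := eLpNorm_nnreal_pow_eq_lintegral (μ := (volume : Measure (Space n)))
    (f := ((𝓕 (besselS s f) : 𝓢(Space n, ℂ)) : Space n → ℂ)) (p := 2) two_ne_zero
  simp only [NNReal.coe_ofNat, ENNReal.coe_ofNat, ENNReal.rpow_ofNat] at h2
  rw [hNorm_ofSchwartz, h1, h2]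
  simp only [fourier_besselS, enorm_mul]

/-- Schwartz functions are dense in `H^s`. -/
theorem exists_schwartz_tendsto {s : Fin j → ℝ} {T : 𝓢'(Space n, ℂ)} (hT : MemH s T) :
    ∃ f : ℕ → 𝓢(Space n, ℂ), Tendsto (fun k => hNorm s (T - ofSchwartz (f k))) atTop (𝓝 0) := by
  obtain ⟨g, hg⟩ := hT
  have hd := SchwartzMap.denseRange_toLpCLM (E := Space n) (F := ℂ) (p := 2) (μ := volume)
    ENNReal.ofNat_ne_top
  obtain ⟨u, hu, hlim⟩ := mem_closure_iff_seq_limit.1 (hd g)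
  choose v hv using hu
  refine ⟨fun k => besselS (-s) (v k), ?_⟩
  have key (k : ℕ) : hNorm s (T - ofSchwartz (besselS (-s) (v k))) = ‖g - u k‖ₑ := by
    refine hNorm_eq ?_
    rw [map_sub, ← bessel_ofSchwartz, bessel_bessel_neg, hg, ← hv k]
    rw [show ofSchwartz (v k) = (((v k).toLp 2 volume : Lp ℂ 2 (volume : Measure (Space n))) :
      𝓢'(Space n, ℂ)) from (Lp.toTemperedDistribution_toLp_eq _).symm]
    exact (map_sub (Lp.toTemperedDistributionCLM ℂ volume 2) g _).symm
  simp only [key]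
  have := (tendsto_const_nhds (x := g)).sub hlim
  rw [sub_self] at this
  simpa using this.enorm

/-- Every functional `T ↦ T h` is bounded on `H^s`. -/
theorem exists_enorm_apply_le (s : Fin j → ℝ) (h : 𝓢(Space n, ℂ)) :
    ∃ C : ℝ≥0, ∀ T : 𝓢'(Space n, ℂ), ‖T h‖ₑ ≤ C * hNorm s T := by
  -- `h'` is the transpose of `⟨⟨D⟩⟩^{-s}` applied to `h`
  let h' : 𝓢(Space n, ℂ) := 𝓕 (SchwartzMap.smulLeftCLM ℂ (symbol (-s)) (𝓕⁻ h))
  let L : Lp ℂ 2 (volume : Measure (Space n)) →L[ℂ] ℂ :=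
    (PointwiseConvergenceCLM.evalCLM (RingHom.id ℂ) ℂ h').comp
      (Lp.toTemperedDistributionCLM ℂ volume 2)
  refine ⟨‖L‖₊ + 1, fun T => ?_⟩
  by_cases hT : MemH s T
  · obtain ⟨f, hf⟩ := hT
    have : T h = L f := by
      rw [← bessel_neg_bessel s T, hf]
      rfl
    rw [this, hNorm_eq hf]
    calc ‖L f‖ₑ ≤ ‖L‖ₑ * ‖f‖ₑ := L.le_opENorm f
      _ ≤ _ := by
        gcongr
        rw [ENNReal.coe_add]
        exact le_self_add
  · rw [hNorm_eq_top hT, ENNReal.mul_top (by simp)]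
    exact le_top

/-- Convergence in `H^s` implies weak convergence. -/
theorem tendsto_apply_of_hNorm {s : Fin j → ℝ} {T : 𝓢'(Space n, ℂ)} {U : ℕ → 𝓢'(Space n, ℂ)}
    (h : Tendsto (fun k => hNorm s (T - U k)) atTop (𝓝 0)) (f : 𝓢(Space n, ℂ)) :
    Tendsto (fun k => U k f) atTop (𝓝 (T f)) := by
  obtain ⟨C, hC⟩ := exists_enorm_apply_le s f
  have h1 : Tendsto (fun k => C * hNorm s (T - U k)) atTop (𝓝 0) := by
    simpa using ENNReal.Tendsto.const_mul h (Or.inr ENNReal.coe_ne_top)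
  rw [tendsto_iff_edist_tendsto_0]
  refine tendsto_of_tendsto_of_tendsto_of_le_of_le tendsto_const_nhds h1 (fun _ => zero_le)
    fun k => ?_
  dsimp only
  rw [edist_comm, edist_eq_enorm_sub]
  exact hC (T - U k)

/-! ### The product estimate for Schwartz functions -/

/-- The pointwise product of Schwartz functions. -/
def schwartzMul (f g : 𝓢(Space n, ℂ)) : 𝓢(Space n, ℂ) :=
  SchwartzMap.pairing (ContinuousLinearMap.mul ℂ ℂ) f g

@[simp] theorem schwartzMul_apply (f g : 𝓢(Space n, ℂ)) (x : Space n) :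
    schwartzMul f g x = f x * g x := rfl

/-- The convolution theorem.  Mathlib's convolution of Schwartz functions is defined through `𝓕⁻`,
and `𝓕⁻ h (ξ) = 𝓕 h (-ξ)`. -/
theorem fourier_schwartzMul (f g : 𝓢(Space n, ℂ)) (ξ : Space n) :
    𝓕 (schwartzMul f g) ξ = ∫ η, 𝓕 f η * 𝓕 g (ξ - η) := by
  have hinv (h : 𝓢(Space n, ℂ)) (x : Space n) : 𝓕⁻ h x = 𝓕 h (-x) := by
    rw [SchwartzMap.fourierInv_coe, SchwartzMap.fourier_coe, Real.fourierInv_eq_fourier_neg]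
  have h1 : 𝓕⁻ (schwartzMul f g) =
      SchwartzMap.convolution (ContinuousLinearMap.mul ℂ ℂ) (𝓕⁻ f) (𝓕⁻ g) := by
    simp [SchwartzMap.convolution, schwartzMul]
  have h2 : 𝓕 (schwartzMul f g) ξ = 𝓕⁻ (schwartzMul f g) (-ξ) := by rw [hinv, neg_neg]
  rw [h2, h1, SchwartzMap.convolution_apply, convolution_def,
    ← integral_neg_eq_self]
  refine integral_congr_ae (Eventually.of_forall fun η => ?_)
  simp only [ContinuousLinearMap.mul_apply', hinv, neg_neg]
  congr 2
  abel

/-- The Cauchy-Schwarz inequality. -/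
theorem sq_lintegral_mul_le {α : Type*} [MeasurableSpace α] {μ : Measure α} {a b : α → ℝ≥0∞}
    (ha : AEMeasurable a μ) (hb : AEMeasurable b μ) :
    (∫⁻ x, a x * b x ∂μ) ^ 2 ≤ (∫⁻ x, a x ^ 2 ∂μ) * ∫⁻ x, b x ^ 2 ∂μ := by
  have h := ENNReal.lintegral_mul_le_Lp_mul_Lq μ Real.HolderConjugate.two_two ha hb
  simp only [Pi.mul_apply, ENNReal.rpow_ofNat] at h
  calc (∫⁻ x, a x * b x ∂μ) ^ 2
      ≤ ((∫⁻ x, a x ^ 2 ∂μ) ^ (1 / 2 : ℝ) * (∫⁻ x, b x ^ 2 ∂μ) ^ (1 / 2 : ℝ)) ^ 2 := by gcongr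
    _ = _ := by
      rw [mul_pow, ← ENNReal.rpow_natCast, ← ENNReal.rpow_natCast, ← ENNReal.rpow_mul,
        ← ENNReal.rpow_mul]
      norm_num

theorem continuous_symbol (s : Fin j → ℝ) : Continuous (symbol s : Space n → ℂ) :=
  (symbol_hasTemperateGrowth s).1.continuous

theorem continuous_decay (m : Fin j → ℝ) :
    Continuous fun p : Space n × Space n => decay m p.1 p.2 := by
  unfold decay
  refine continuous_finsetProd _ fun l _ => ?_
  exact (Continuous.rpow_const (by fun_prop) fun x => Or.inl (by positivity)).add
    (Continuous.rpow_const (by fun_prop) fun x => Or.inl (by positivity))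

/-- The product estimate for Schwartz functions.  On the Fourier side, the kernel of the product is
square integrable in `η` uniformly in `ξ`, so the Cauchy-Schwarz inequality suffices. -/
theorem exists_hNorm_schwartzMul_le (hn : ∀ l, 0 < n l) {s t ε σ : Fin j → ℝ}
    (hε : ∀ l, 0 < ε l ∧ ε l < s l + t l - (n l : ℝ) / 2)
    (hσ : ∀ l, σ l = min (s l) (min (t l) (s l + t l - (n l : ℝ) / 2 - ε l))) :
    ∃ C : ℝ≥0, ∀ f g : 𝓢(Space n, ℂ), hNorm σ (ofSchwartz (schwartzMul f g)) ≤
      C * hNorm s (ofSchwartz f) * hNorm t (ofSchwartz g) := by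
  let m : Fin j → ℝ := fun l => (n l : ℝ) / 2 + ε l
  have hc : 1 ≤ 2 * Real.pi := by linarith [Real.pi_gt_three]
  obtain ⟨C₁, hC₁⟩ := exists_lintegral_decay_le (m := m) hn
    (fun l => by have := (hε l).1; simp only [m]; linarith) hc
  set c : ℝ := 2 * Real.pi
  let K : ℝ := ∏ l, (4 : ℝ) ^ (|s l| + |t l|)
  have hK : 0 ≤ K := Finset.prod_nonneg fun _ _ => by positivity
  let C₂ : ℝ≥0 := K.toNNReal * C₁
  refine ⟨NNReal.sqrt C₂, fun f g => ?_⟩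
  let F (η : Space n) : ℝ≥0∞ := ‖symbol s η‖ₑ * ‖𝓕 f η‖ₑ
  let G (η : Space n) : ℝ≥0∞ := ‖symbol t η‖ₑ * ‖𝓕 g η‖ₑ
  have hFm : Measurable F := by
    have := continuous_symbol s (n := n)
    have := (𝓕 f).continuous
    fun_prop
  have hGm : Measurable G := by
    have := continuous_symbol t (n := n)
    have := (𝓕 g).continuous
    fun_prop
  -- `F` and `G` have `L²` norms `‖f‖_s` and `‖g‖_t`, and `k` bounds the kernel of the product
  let k (ξ η : Space n) : ℝ≥0∞ := ENNReal.ofReal (√(K * decay m (c • (ξ - η)) (c • η)))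
  have hkm (ξ) : Measurable (k ξ) := by
    have h1 : Continuous fun η => decay m (c • (ξ - η)) (c • η) :=
      (continuous_decay m).comp (f := fun η => (c • (ξ - η), c • η)) (by fun_prop)
    exact (ENNReal.continuous_ofReal.comp (continuous_const.mul h1).sqrt).measurable
  have hk2 (ξ) : ∫⁻ η, k ξ η ^ 2 ≤ C₂ := by
    have h1 (η) : k ξ η ^ 2 =
        ENNReal.ofReal K * ENNReal.ofReal (decay m (c • (ξ - η)) (c • η)) := by
      simp only [k]
      rw [← ENNReal.ofReal_pow (Real.sqrt_nonneg _),
        Real.sq_sqrt (mul_nonneg hK (decay_nonneg _ _ _)), ENNReal.ofReal_mul hK]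
    simp only [h1]
    rw [lintegral_const_mul' _ _ ENNReal.ofReal_ne_top]
    simp only [C₂, ENNReal.coe_mul]
    exact mul_le_mul' le_rfl (hC₁ ξ)
  have hker (ξ η : Space n) :
      ‖symbol σ ξ‖ₑ ≤ k ξ η * (‖symbol s η‖ₑ * ‖symbol t (ξ - η)‖ₑ) := by
    simp only [enorm_symbol, k]
    rw [← ENNReal.ofReal_mul (weight_pos _ _).le, ← ENNReal.ofReal_mul (Real.sqrt_nonneg _)]
    refine ENNReal.ofReal_le_ofReal (abs_le_of_sq_le_sq' ?_ ?_).2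
    · rw [mul_pow, Real.sq_sqrt (mul_nonneg hK (decay_nonneg _ _ _)), mul_pow]
      have := weight_add_sq_le hε hσ (c • η) (c • (ξ - η))
      rw [← smul_add, add_sub_cancel, decay_comm] at this
      refine this.trans (le_of_eq ?_)
      simp only [K, m, c]
      ring
    · exact mul_nonneg (Real.sqrt_nonneg _) (mul_pos (weight_pos _ _) (weight_pos _ _)).le
  have hpt (ξ) : (‖symbol σ ξ‖ₑ * ‖𝓕 (schwartzMul f g) ξ‖ₑ) ^ 2 ≤
      C₂ * ∫⁻ η, F η ^ 2 * G (ξ - η) ^ 2 := by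
    have h1 : ‖symbol σ ξ‖ₑ * ‖𝓕 (schwartzMul f g) ξ‖ₑ ≤ ∫⁻ η, k ξ η * (F η * G (ξ - η)) := by
      calc ‖symbol σ ξ‖ₑ * ‖𝓕 (schwartzMul f g) ξ‖ₑ
          ≤ ‖symbol σ ξ‖ₑ * ∫⁻ η, ‖𝓕 f η * 𝓕 g (ξ - η)‖ₑ := by
            rw [fourier_schwartzMul]
            gcongr
            exact enorm_integral_le_lintegral_enorm _
        _ = ∫⁻ η, ‖symbol σ ξ‖ₑ * (‖𝓕 f η‖ₑ * ‖𝓕 g (ξ - η)‖ₑ) := by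
            rw [← lintegral_const_mul' _ _ enorm_ne_top]
            simp only [enorm_mul]
        _ ≤ _ := by
            refine lintegral_mono fun η => ?_
            calc ‖symbol σ ξ‖ₑ * (‖𝓕 f η‖ₑ * ‖𝓕 g (ξ - η)‖ₑ)
                ≤ (k ξ η * (‖symbol s η‖ₑ * ‖symbol t (ξ - η)‖ₑ)) *
                    (‖𝓕 f η‖ₑ * ‖𝓕 g (ξ - η)‖ₑ) := by
                  gcongr
                  exact hker ξ η
              _ = _ := by simp only [F, G]; ring
    calc (‖symbol σ ξ‖ₑ * ‖𝓕 (schwartzMul f g) ξ‖ₑ) ^ 2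
        ≤ (∫⁻ η, k ξ η * (F η * G (ξ - η))) ^ 2 := by gcongr
      _ ≤ (∫⁻ η, k ξ η ^ 2) * ∫⁻ η, (F η * G (ξ - η)) ^ 2 :=
          sq_lintegral_mul_le (hkm ξ).aemeasurable
            (hFm.mul (hGm.comp (measurable_const.sub measurable_id))).aemeasurable
      _ ≤ _ := by
          simp only [mul_pow]
          gcongr
          exact hk2 ξ
  have htot : hNorm σ (ofSchwartz (schwartzMul f g)) ^ 2 ≤
      C₂ * (hNorm s (ofSchwartz f) ^ 2 * hNorm t (ofSchwartz g) ^ 2) := by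
    calc hNorm σ (ofSchwartz (schwartzMul f g)) ^ 2
        ≤ ∫⁻ ξ, C₂ * ∫⁻ η, F η ^ 2 * G (ξ - η) ^ 2 := by
          rw [hNorm_ofSchwartz_sq]
          exact lintegral_mono hpt
      _ = C₂ * ∫⁻ η, ∫⁻ ξ, F η ^ 2 * G (ξ - η) ^ 2 := by
          rw [lintegral_const_mul' _ _ ENNReal.coe_ne_top, lintegral_lintegral_swap]
          exact (((hFm.comp measurable_snd).pow_const 2).mul
            ((hGm.comp (measurable_fst.sub measurable_snd)).pow_const 2)).aemeasurable
      _ = C₂ * ∫⁻ η, F η ^ 2 * ∫⁻ ξ, G ξ ^ 2 := by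
          congr 1
          refine lintegral_congr fun η => ?_
          rw [lintegral_const_mul' _ _
            (ENNReal.pow_ne_top (ENNReal.mul_ne_top enorm_ne_top enorm_ne_top))]
          congr 1
          exact lintegral_sub_right_eq_self (fun ξ => G ξ ^ 2) η
      _ = _ := by
          rw [lintegral_mul_const _ (hFm.pow_const 2), hNorm_ofSchwartz_sq, hNorm_ofSchwartz_sq]
  rw [← ENNReal.pow_le_pow_left_iff two_ne_zero]
  refine htot.trans (le_of_eq ?_)
  rw [mul_pow, mul_pow, ← ENNReal.coe_pow, NNReal.sq_sqrt, mul_assoc]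

/-! ### Products in Sobolev spaces -/

/-- Products are unique, because approximating sequences exist. -/
theorem IsProdH.unique {s t : Fin j → ℝ} {S T W W' : 𝓢'(Space n, ℂ)}
    (h : IsProdH s t S T W) (h' : IsProdH s t S T W') : W = W' := by
  obtain ⟨f, hf⟩ := exists_schwartz_tendsto h.1
  obtain ⟨g, hg⟩ := exists_schwartz_tendsto h.2.1
  ext φ
  exact tendsto_nhds_unique (h.2.2 f g hf hg φ) (h'.2.2 f g hf hg φ)

theorem ofSchwartz_schwartzMul_apply (f g h : 𝓢(Space n, ℂ)) :
    ofSchwartz (schwartzMul f g) h = ∫ x, f x * g x * h x := by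
  rw [ofSchwartz_apply]
  refine integral_congr_ae (Eventually.of_forall fun x => ?_)
  simp only [schwartzMul_apply]
  ring

/-- If the product estimate holds for Schwartz functions, the products of two approximating
sequences of the same pair `S`, `T` approach each other in `H^σ`. -/
theorem tendsto_hNorm_schwartzMul_sub {s t σ : Fin j → ℝ} {C : ℝ≥0}
    (hC : ∀ f g : 𝓢(Space n, ℂ), hNorm σ (ofSchwartz (schwartzMul f g)) ≤
      C * hNorm s (ofSchwartz f) * hNorm t (ofSchwartz g))
    {S T : 𝓢'(Space n, ℂ)} (hS : MemH s S) (hT : MemH t T) {f g f' g' : ℕ → 𝓢(Space n, ℂ)}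
    (hf : Tendsto (fun k => hNorm s (S - ofSchwartz (f k))) atTop (𝓝 0))
    (hg : Tendsto (fun k => hNorm t (T - ofSchwartz (g k))) atTop (𝓝 0))
    (hf' : Tendsto (fun k => hNorm s (S - ofSchwartz (f' k))) atTop (𝓝 0))
    (hg' : Tendsto (fun k => hNorm t (T - ofSchwartz (g' k))) atTop (𝓝 0)) :
    Tendsto (fun p : ℕ × ℕ => hNorm σ (ofSchwartz (schwartzMul (f p.1) (g p.1)) -
      ofSchwartz (schwartzMul (f' p.2) (g' p.2)))) (atTop ×ˢ atTop) (𝓝 0) := by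
  set a := fun k => hNorm s (S - ofSchwartz (f k))
  set b := fun k => hNorm t (T - ofSchwartz (g k))
  set a' := fun k => hNorm s (S - ofSchwartz (f' k))
  set b' := fun k => hNorm t (T - ofSchwartz (g' k))
  have hle (p : ℕ × ℕ) : hNorm σ (ofSchwartz (schwartzMul (f p.1) (g p.1)) -
      ofSchwartz (schwartzMul (f' p.2) (g' p.2))) ≤
      C * (a p.1 + a' p.2) * (hNorm t T + b p.1) +
        C * (hNorm s S + a' p.2) * (b p.1 + b' p.2) := by
    -- `f g - f' g' = (f - f') g + f' (g - g')`
    have h1 : ofSchwartz (schwartzMul (f p.1) (g p.1)) - ofSchwartz (schwartzMul (f' p.2) (g' p.2))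
        = ofSchwartz (schwartzMul (f p.1 - f' p.2) (g p.1)) +
          ofSchwartz (schwartzMul (f' p.2) (g p.1 - g' p.2)) := by
      rw [← map_sub, ← map_add]
      congr 1
      ext x
      simp
      ring
    rw [h1]
    refine (hNorm_add_le _ _ _).trans (add_le_add ((hC _ _).trans ?_) ((hC _ _).trans ?_))
    · gcongr
      · rw [map_sub]
        refine (hNorm_sub_le s _ S _).trans ?_
        rw [hNorm_sub_comm s _ S]
      · have := hNorm_sub_le t (ofSchwartz (g p.1)) T 0
        rw [sub_zero, sub_zero, hNorm_sub_comm, add_comm] at this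
        exact this
    · gcongr
      · have := hNorm_sub_le s (ofSchwartz (f' p.2)) S 0
        rw [sub_zero, sub_zero, hNorm_sub_comm, add_comm] at this
        exact this
      · rw [map_sub]
        refine (hNorm_sub_le t _ T _).trans ?_
        rw [hNorm_sub_comm t _ T]
  refine tendsto_of_tendsto_of_tendsto_of_le_of_le tendsto_const_nhds ?_ (fun _ => zero_le) hle
  have ha1 := hf.comp (tendsto_fst (f := (atTop : Filter ℕ)) (g := (atTop : Filter ℕ)))
  have hb1 := hg.comp (tendsto_fst (f := (atTop : Filter ℕ)) (g := (atTop : Filter ℕ)))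
  have ha2 := hf'.comp (tendsto_snd (f := (atTop : Filter ℕ)) (g := (atTop : Filter ℕ)))
  have hb2 := hg'.comp (tendsto_snd (f := (atTop : Filter ℕ)) (g := (atTop : Filter ℕ)))
  have hS' := (memH_iff.1 hS).ne
  have hT' := (memH_iff.1 hT).ne
  have e1 : Tendsto (fun p : ℕ × ℕ => C * (a p.1 + a' p.2) * (hNorm t T + b p.1))
      (atTop ×ˢ atTop) (𝓝 (C * (0 + 0) * (hNorm t T + 0))) := by
    refine ENNReal.Tendsto.mul (ENNReal.Tendsto.const_mul (ha1.add ha2) (Or.inr ENNReal.coe_ne_top))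
      (Or.inr (by simpa using hT')) (tendsto_const_nhds.add hb1) (Or.inr (by simp))
  have e2 : Tendsto (fun p : ℕ × ℕ => C * (hNorm s S + a' p.2) * (b p.1 + b' p.2))
      (atTop ×ˢ atTop) (𝓝 (C * (hNorm s S + 0) * (0 + 0))) := by
    refine ENNReal.Tendsto.mul (ENNReal.Tendsto.const_mul (tendsto_const_nhds.add ha2)
      (Or.inr ENNReal.coe_ne_top)) (Or.inr (by simp)) (hb1.add hb2)
      (Or.inr (by simpa using ENNReal.mul_ne_top ENNReal.coe_ne_top hS'))
  simpa using e1.add e2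

/-- Extension by continuity: the product of `S ∈ H^s` and `T ∈ H^t` exists and is in `H^σ`. -/
theorem exists_isProdH_of_schwartz {s t σ : Fin j → ℝ} {C : ℝ≥0}
    (hC : ∀ f g : 𝓢(Space n, ℂ), hNorm σ (ofSchwartz (schwartzMul f g)) ≤
      C * hNorm s (ofSchwartz f) * hNorm t (ofSchwartz g))
    {S T : 𝓢'(Space n, ℂ)} (hS : MemH s S) (hT : MemH t T) :
    ∃ W, IsProdH s t S T W ∧ hNorm σ W ≤ C * hNorm s S * hNorm t T := by
  obtain ⟨f, hf⟩ := exists_schwartz_tendsto hS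
  obtain ⟨g, hg⟩ := exists_schwartz_tendsto hT
  let b (k : ℕ) : Lp ℂ 2 (volume : Measure (Space n)) :=
    (besselS σ (schwartzMul (f k) (g k))).toLp 2 volume
  have hb (k) : bessel σ (ofSchwartz (schwartzMul (f k) (g k))) = (b k : 𝓢'(Space n, ℂ)) :=
    (bessel_ofSchwartz _ _).trans (Lp.toTemperedDistribution_toLp_eq _).symm
  have hsub (u v : Lp ℂ 2 (volume : Measure (Space n))) :
      (u : 𝓢'(Space n, ℂ)) - (v : 𝓢'(Space n, ℂ)) =
        ((u - v : Lp ℂ 2 (volume : Measure (Space n))) : 𝓢'(Space n, ℂ)) :=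
    (map_sub (Lp.toTemperedDistributionCLM ℂ volume 2) u v).symm
  have hcauchy : CauchySeq b := by
    rw [cauchySeq_iff_tendsto_dist_atTop_0]
    have h1 := tendsto_hNorm_schwartzMul_sub hC hS hT hf hg hf hg
    rw [prod_atTop_atTop_eq] at h1
    have h2 := (ENNReal.tendsto_toReal ENNReal.zero_ne_top).comp h1
    refine h2.congr fun p => ?_
    have h3 := hNorm_eq (s := σ) (T := ofSchwartz (schwartzMul (f p.1) (g p.1)) -
      ofSchwartz (schwartzMul (f p.2) (g p.2))) (f := b p.1 - b p.2)
      (by rw [map_sub, hb, hb, hsub])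
    simp only [Function.comp_apply]
    rw [h3, toReal_enorm, dist_eq_norm]
  obtain ⟨B, hB⟩ := cauchySeq_tendsto_of_complete hcauchy
  let W : 𝓢'(Space n, ℂ) := bessel (-σ) (B : 𝓢'(Space n, ℂ))
  have hW : bessel σ W = (B : 𝓢'(Space n, ℂ)) := bessel_bessel_neg _ _
  have hWlim : Tendsto (fun k => hNorm σ (W - ofSchwartz (schwartzMul (f k) (g k)))) atTop
      (𝓝 0) := by
    have h1 (k) : hNorm σ (W - ofSchwartz (schwartzMul (f k) (g k))) = ‖B - b k‖ₑ :=
      hNorm_eq (by rw [map_sub, hb, hW, hsub])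
    simp only [h1]
    have := (tendsto_const_nhds (x := B)).sub hB
    rw [sub_self] at this
    simpa using this.enorm
  refine ⟨W, ⟨hS, hT, fun f' g' hf' hg' h => ?_⟩, ?_⟩
  · have h1 : Tendsto (fun k => hNorm σ (W - ofSchwartz (schwartzMul (f' k) (g' k)))) atTop
        (𝓝 0) := by
      have h2 := (tendsto_hNorm_schwartzMul_sub hC hS hT hf hg hf' hg').comp
        (tendsto_id.prodMk tendsto_id : Tendsto (fun k : ℕ => (k, k)) atTop (atTop ×ˢ atTop))
      have h3 := hWlim.add h2
      rw [add_zero] at h3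
      exact tendsto_of_tendsto_of_tendsto_of_le_of_le tendsto_const_nhds h3 (fun _ => zero_le)
        fun k => hNorm_sub_le _ _ _ _
    simpa only [ofSchwartz_schwartzMul_apply] using tendsto_apply_of_hNorm h1 h
  · have h1 (k) : hNorm σ W ≤ hNorm σ (W - ofSchwartz (schwartzMul (f k) (g k))) +
        C * (hNorm s S + hNorm s (S - ofSchwartz (f k))) *
          (hNorm t T + hNorm t (T - ofSchwartz (g k))) := by
      have h2 := hNorm_sub_le σ W (ofSchwartz (schwartzMul (f k) (g k))) 0
      rw [sub_zero, sub_zero] at h2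
      refine h2.trans (add_le_add le_rfl ((hC _ _).trans ?_))
      gcongr
      · have := hNorm_sub_le s (ofSchwartz (f k)) S 0
        rw [sub_zero, sub_zero, hNorm_sub_comm, add_comm] at this
        exact this
      · have := hNorm_sub_le t (ofSchwartz (g k)) T 0
        rw [sub_zero, sub_zero, hNorm_sub_comm, add_comm] at this
        exact this
    have hS' := (memH_iff.1 hS).ne
    have hT' := (memH_iff.1 hT).ne
    have h3 : Tendsto (fun k => hNorm σ (W - ofSchwartz (schwartzMul (f k) (g k))) +
        C * (hNorm s S + hNorm s (S - ofSchwartz (f k))) *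
          (hNorm t T + hNorm t (T - ofSchwartz (g k)))) atTop
        (𝓝 (0 + C * (hNorm s S + 0) * (hNorm t T + 0))) := by
      refine hWlim.add (ENNReal.Tendsto.mul (ENNReal.Tendsto.const_mul (tendsto_const_nhds.add hf)
        (Or.inr ENNReal.coe_ne_top)) (Or.inr (by simpa using hT')) (tendsto_const_nhds.add hg)
        (Or.inr (by simpa using ENNReal.mul_ne_top ENNReal.coe_ne_top hS')))
    simp only [zero_add, add_zero] at h3
    exact ge_of_tendsto' h3 h1

/-- The product `H^s × H^t → H^σ` exists and is bounded. -/
theorem exists_isProdH (hn : ∀ l, 0 < n l) {s t ε σ : Fin j → ℝ}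
    (hε : ∀ l, 0 < ε l ∧ ε l < s l + t l - (n l : ℝ) / 2)
    (hσ : ∀ l, σ l = min (s l) (min (t l) (s l + t l - (n l : ℝ) / 2 - ε l))) :
    ∃ C : ℝ≥0, (∀ S T : 𝓢'(Space n, ℂ), MemH s S → MemH t T → ∃ W, IsProdH s t S T W) ∧
      ∀ S T W : 𝓢'(Space n, ℂ), IsProdH s t S T W →
        hNorm σ W ≤ C * hNorm s S * hNorm t T := by
  obtain ⟨C, hC⟩ := exists_hNorm_schwartzMul_le hn hε hσ
  refine ⟨C, fun S T hS hT => ?_, fun S T W hW => ?_⟩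
  · obtain ⟨W, hW, -⟩ := exists_isProdH_of_schwartz hC hS hT
    exact ⟨W, hW⟩
  · obtain ⟨W', hW', hle⟩ := exists_isProdH_of_schwartz hC hW.1 hW.2.1
    rwa [hW.unique hW']

/-! ### Multiplication by Schwartz functions -/

/-- The product of a Schwartz function and a tempered distribution. -/
abbrev schwartzSmul (φ : 𝓢(Space n, ℂ)) : 𝓢'(Space n, ℂ) →L[ℂ] 𝓢'(Space n, ℂ) :=
  TemperedDistribution.smulLeftCLM ℂ φ

theorem schwartzSmul_apply (φ : 𝓢(Space n, ℂ)) (T : 𝓢'(Space n, ℂ)) (h : 𝓢(Space n, ℂ)) :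
    schwartzSmul φ T h = T (schwartzMul φ h) := by
  rw [TemperedDistribution.smulLeftCLM_apply_apply]
  congr 1
  ext x
  simp [φ.hasTemperateGrowth]

theorem schwartzSmul_ofSchwartz (φ f : 𝓢(Space n, ℂ)) :
    schwartzSmul φ (ofSchwartz f) = ofSchwartz (schwartzMul φ f) := by
  ext h
  rw [schwartzSmul_apply, ofSchwartz_apply, ofSchwartz_schwartzMul_apply]
  refine integral_congr_ae (Eventually.of_forall fun x => ?_)
  simp only [schwartzMul_apply]
  ring

/-- A Sobolev order whose space acts on `H^s` by multiplication. -/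
def multOrder (n : Fin j → ℕ) (s : Fin j → ℝ) : Fin j → ℝ := fun l => |s l| + (n l : ℝ) / 2 + 1

/-- Multiplication by a Schwartz function is bounded on `H^s`, with a bound on its norm in terms of
a Sobolev norm of the function. -/
theorem exists_hNorm_schwartzSmul_le (hn : ∀ l, 0 < n l) (s : Fin j → ℝ) :
    ∃ C : ℝ≥0, ∀ (φ : 𝓢(Space n, ℂ)) (T : 𝓢'(Space n, ℂ)), MemH s T →
      hNorm s (schwartzSmul φ T) ≤ C * hNorm (multOrder n s) (ofSchwartz φ) * hNorm s T := by
  obtain ⟨C, hex, hC⟩ := exists_isProdH (n := n) hn (s := s) (t := multOrder n s)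
    (ε := fun _ => 1 / 2) (σ := s)
    (fun l => ⟨by norm_num, by simp only [multOrder]; linarith [neg_abs_le (s l)]⟩)
    (fun l => by
      have h1 := neg_abs_le (s l)
      have h2 := le_abs_self (s l)
      have h3 : (0 : ℝ) ≤ n l := Nat.cast_nonneg _
      simp only [multOrder]
      rw [min_eq_left]
      exact le_min (by linarith) (by linarith [abs_nonneg (s l)]))
  refine ⟨C, fun φ T hT => ?_⟩
  obtain ⟨W, hW⟩ := hex T (ofSchwartz φ) hT (memH_ofSchwartz _ φ)
  -- approximate `φ ∈ H^t` by the constant sequence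
  have hWφ : W = schwartzSmul φ T := by
    obtain ⟨f, hf⟩ := exists_schwartz_tendsto hT
    ext h
    have h1 := hW.2.2 f (fun _ => φ) hf (by simp [hNorm_zero]) h
    refine tendsto_nhds_unique h1 ?_
    rw [schwartzSmul_apply]
    refine (tendsto_apply_of_hNorm hf (schwartzMul φ h)).congr fun k => ?_
    rw [ofSchwartz_apply]
    refine integral_congr_ae (Eventually.of_forall fun x => ?_)
    simp only [schwartzMul_apply]
    ring
  rw [← hWφ]
  refine (hC _ _ _ hW).trans (le_of_eq (by ring))

theorem MemH.schwartzSmul (hn : ∀ l, 0 < n l) {s : Fin j → ℝ} {T : 𝓢'(Space n, ℂ)}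
    (hT : MemH s T) (φ : 𝓢(Space n, ℂ)) : MemH s (schwartzSmul φ T) := by
  obtain ⟨C, hC⟩ := exists_hNorm_schwartzSmul_le hn s
  refine memH_iff.2 ((hC φ T hT).trans_lt ?_)
  exact ENNReal.mul_lt_top (ENNReal.mul_lt_top ENNReal.coe_lt_top
    (memH_iff.1 (memH_ofSchwartz _ φ))) (memH_iff.1 hT)

theorem tendsto_hNorm_schwartzSmul_sub (hn : ∀ l, 0 < n l) {s : Fin j → ℝ} {T : 𝓢'(Space n, ℂ)}
    (hT : MemH s T) (φ : 𝓢(Space n, ℂ)) {f : ℕ → 𝓢(Space n, ℂ)}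
    (hf : Tendsto (fun k => hNorm s (T - ofSchwartz (f k))) atTop (𝓝 0)) :
    Tendsto (fun k => hNorm s (schwartzSmul φ T - ofSchwartz (schwartzMul φ (f k)))) atTop
      (𝓝 0) := by
  obtain ⟨C, hC⟩ := exists_hNorm_schwartzSmul_le hn s
  have h1 : Tendsto (fun k => C * hNorm (multOrder n s) (ofSchwartz φ) *
      hNorm s (T - ofSchwartz (f k))) atTop (𝓝 0) := by
    simpa using ENNReal.Tendsto.const_mul hf (Or.inr (ENNReal.mul_ne_top ENNReal.coe_ne_top
      (memH_iff.1 (memH_ofSchwartz _ φ)).ne))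
  refine tendsto_of_tendsto_of_tendsto_of_le_of_le tendsto_const_nhds h1 (fun _ => zero_le)
    fun k => ?_
  dsimp only
  rw [← schwartzSmul_ofSchwartz, ← map_sub]
  refine hC φ _ (memH_iff.2 ((hNorm_sub_le s T 0 _).trans_lt ?_))
  rw [sub_zero, zero_sub, hNorm_neg]
  exact ENNReal.add_lt_top.2 ⟨memH_iff.1 hT, memH_iff.1 (memH_ofSchwartz _ _)⟩

/-- Products are compatible with multiplication of both factors by Schwartz functions, provided
that the product of the multiplied factors exists. -/
theorem IsProdH.eq_schwartzSmul (hn : ∀ l, 0 < n l) {s t : Fin j → ℝ} {S T W W' : 𝓢'(Space n, ℂ)}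
    (h : IsProdH s t S T W) {φ ψ : 𝓢(Space n, ℂ)}
    (h' : IsProdH s t (schwartzSmul φ S) (schwartzSmul ψ T) W') :
    W' = schwartzSmul (schwartzMul φ ψ) W := by
  obtain ⟨f, hf⟩ := exists_schwartz_tendsto h.1
  obtain ⟨g, hg⟩ := exists_schwartz_tendsto h.2.1
  ext χ
  refine tendsto_nhds_unique (h'.2.2 _ _ (tendsto_hNorm_schwartzSmul_sub hn h.1 φ hf)
    (tendsto_hNorm_schwartzSmul_sub hn h.2.1 ψ hg) χ) ?_
  rw [schwartzSmul_apply]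
  refine (h.2.2 f g hf hg _).congr fun k => ?_
  refine integral_congr_ae (Eventually.of_forall fun x => ?_)
  simp only [schwartzMul_apply]
  ring

/-! ### Translations -/

/-- Translation of a Schwartz function. -/
abbrev shift (y : Space n) (f : 𝓢(Space n, ℂ)) : 𝓢(Space n, ℂ) := f.compSubConstCLM ℂ y

theorem fourier_shift (y : Space n) (f : 𝓢(Space n, ℂ)) (ξ : Space n) :
    𝓕 (shift y f) ξ = Real.fourierChar (-(inner ℝ y ξ)) • 𝓕 f ξ := by
  have h := congrFun (VectorFourier.fourierIntegral_comp_add_right Real.fourierChar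
    (volume : Measure (Space n)) (innerₗ (Space n)) (f : Space n → ℂ) (-y)) ξ
  simp only [map_neg, LinearMap.neg_apply, innerₗ_apply_apply] at h
  rw [SchwartzMap.fourier_coe, SchwartzMap.fourier_coe]
  refine Eq.trans ?_ h
  rw [Real.fourier_eq]
  simp only [VectorFourier.fourierIntegral, innerₗ_apply_apply, Function.comp_apply,
    SchwartzMap.compSubConstCLM_apply, sub_eq_add_neg]

theorem hNorm_shift (s : Fin j → ℝ) (y : Space n) (f : 𝓢(Space n, ℂ)) :
    hNorm s (ofSchwartz (shift y f)) = hNorm s (ofSchwartz f) := by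
  refine (ENNReal.pow_right_strictMono two_ne_zero).injective ?_
  simp only [hNorm_ofSchwartz_sq, fourier_shift]
  refine lintegral_congr fun ξ => ?_
  rw [← ofReal_norm (_ • _), Circle.norm_smul, ofReal_norm]

/-- Translation is continuous in the Sobolev norms. -/
theorem tendsto_hNorm_shift_sub (s : Fin j → ℝ) (z : Space n) (f : 𝓢(Space n, ℂ)) :
    Tendsto (fun y => hNorm s (ofSchwartz (shift y f - shift z f))) (𝓝 z) (𝓝 0) := by
  have hsq : Tendsto (fun y => hNorm s (ofSchwartz (shift y f - shift z f)) ^ 2) (𝓝 z) (𝓝 0) := by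
    have hF (y ξ) : 𝓕 (shift y f - shift z f) ξ =
        Real.fourierChar (-(inner ℝ y ξ)) • 𝓕 f ξ - Real.fourierChar (-(inner ℝ z ξ)) • 𝓕 f ξ := by
      have : 𝓕 (shift y f - shift z f) = 𝓕 (shift y f) - 𝓕 (shift z f) :=
        map_sub (FourierTransform.fourierCLM ℂ 𝓢(Space n, ℂ)) _ _
      rw [this, sub_apply, fourier_shift, fourier_shift]
    simp only [hNorm_ofSchwartz_sq, hF]
    have h0 : (0 : ℝ≥0∞) = ∫⁻ _ξ : Space n, 0 := by simp
    rw [h0]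
    have hsymb := continuous_symbol s (n := n)
    have hcf := (𝓕 f).continuous
    refine tendsto_lintegral_filter_of_dominated_convergence
      (fun ξ => 4 * (‖symbol s ξ‖ₑ * ‖𝓕 f ξ‖ₑ) ^ 2)
      (Eventually.of_forall fun y => ?_) (Eventually.of_forall fun y => ae_of_all _ fun ξ => ?_)
      ?_ (ae_of_all _ fun ξ => ?_)
    · have : Continuous fun ξ => Real.fourierChar (-(inner ℝ y ξ)) • 𝓕 f ξ -
          Real.fourierChar (-(inner ℝ z ξ)) • 𝓕 f ξ := by fun_prop
      fun_prop
    · have h1 : ‖Real.fourierChar (-(inner ℝ y ξ)) • 𝓕 f ξ -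
          Real.fourierChar (-(inner ℝ z ξ)) • 𝓕 f ξ‖ₑ ≤ 2 * ‖𝓕 f ξ‖ₑ := by
        refine (enorm_sub_le).trans (le_of_eq ?_)
        rw [← ofReal_norm (_ • _), ← ofReal_norm (_ • _), Circle.norm_smul, Circle.norm_smul,
          ofReal_norm, two_mul]
      calc _ ≤ (‖symbol s ξ‖ₑ * (2 * ‖𝓕 f ξ‖ₑ)) ^ 2 := by gcongr
        _ = _ := by ring
    · rw [lintegral_const_mul' _ _ (by norm_num), ← hNorm_ofSchwartz_sq]
      exact ENNReal.mul_ne_top (by norm_num)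
        (ENNReal.pow_ne_top (memH_iff.1 (memH_ofSchwartz s f)).ne)
    · have h1 : Continuous fun y : Space n => (‖symbol s ξ‖ₑ *
          ‖Real.fourierChar (-(inner ℝ y ξ)) • 𝓕 f ξ -
            Real.fourierChar (-(inner ℝ z ξ)) • 𝓕 f ξ‖ₑ) ^ 2 := by
        have : Continuous fun y : Space n => ‖Real.fourierChar (-(inner ℝ y ξ)) • 𝓕 f ξ -
            Real.fourierChar (-(inner ℝ z ξ)) • 𝓕 f ξ‖ₑ := by fun_prop
        exact (ENNReal.continuous_pow 2).comp
          (ENNReal.continuous_const_mul enorm_ne_top |>.comp this)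
      have h2 := h1.tendsto z
      simpa using h2
  have h1 := (ENNReal.continuous_rpow_const (y := (1 / 2 : ℝ))).tendsto 0 |>.comp hsq
  simp only [Function.comp_def, ← ENNReal.rpow_natCast, ← ENNReal.rpow_mul] at h1
  norm_num at h1
  simpa using h1

/-! ### Cutoff functions -/

/-- A test function as a Schwartz function. -/
def toSchwartz (φ : Test n) : 𝓢(Space n, ℂ) := φ.hasCompactSupport.toSchwartzMap φ.contDiff

@[simp] theorem toSchwartz_apply (φ : Test n) (x : Space n) : toSchwartz φ x = φ x := rfl

@[simp] theorem testMul_apply (φ ψ : Test n) (x : Space n) : testMul φ ψ x = φ x * ψ x := rfl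

@[simp] theorem translate_apply (y : Space n) (φ : Test n) (x : Space n) :
    translate y φ x = φ (x - y) := rfl

/-- A test function that is `1` on the ball of radius `N + 1` and `0` off the ball of radius
`N + 2`. -/
def cutoff (n : Fin j → ℕ) (N : ℕ) : Test n :=
  let b : ContDiffBump (0 : Space n) := ⟨N + 1, N + 2, by positivity, by linarith⟩
  { toFun := fun x => (b x : ℂ)
    contDiff' := Complex.ofRealCLM.contDiff.comp b.contDiff
    hasCompactSupport' := b.hasCompactSupport.comp_left Complex.ofReal_zero
    tsupport_subset' := fun _ _ => trivial }

theorem cutoff_eq_one {N : ℕ} {x : Space n} (hx : ‖x‖ ≤ N + 1) : cutoff n N x = 1 := by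
  let b : ContDiffBump (0 : Space n) := ⟨N + 1, N + 2, by positivity, by linarith⟩
  change ((b x : ℝ) : ℂ) = 1
  rw [b.one_of_mem_closedBall (by simpa [b] using hx), Complex.ofReal_one]

theorem cutoff_eq_zero {N : ℕ} {x : Space n} (hx : (N : ℝ) + 2 ≤ ‖x‖) : cutoff n N x = 0 := by
  let b : ContDiffBump (0 : Space n) := ⟨N + 1, N + 2, by positivity, by linarith⟩
  change ((b x : ℝ) : ℂ) = 0
  rw [b.zero_of_le_dist (by simpa [b] using hx), Complex.ofReal_zero]

theorem cutoff_ne_zero (N : ℕ) : cutoff n N ≠ 0 := by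
  intro h
  have h1 : cutoff n N 0 = 1 := cutoff_eq_one (by rw [norm_zero]; positivity)
  rw [h] at h1
  exact zero_ne_one h1

theorem exists_norm_le_of_hasCompactSupport {F : Type*} [Zero F] {f : Space n → F}
    (hf : HasCompactSupport f) : ∃ N : ℕ, ∀ x, f x ≠ 0 → ‖x‖ ≤ N := by
  obtain ⟨R, hR⟩ := hf.isBounded.exists_norm_le
  obtain ⟨N, hN⟩ := exists_nat_ge R
  exact ⟨N, fun x hx => (hR x (subset_tsupport _ hx)).trans hN⟩

theorem exists_cutoff (φ : Test n) : ∃ N : ℕ, ∀ M, N ≤ M → ∀ x, φ x * cutoff n M x = φ x := by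
  obtain ⟨N, hN⟩ := exists_norm_le_of_hasCompactSupport φ.hasCompactSupport
  refine ⟨N, fun M hM x => ?_⟩
  by_cases hx : φ x = 0
  · simp [hx]
  · have h1 : (N : ℝ) ≤ M := by exact_mod_cast hM
    rw [cutoff_eq_one (by linarith [hN x hx]), mul_one]

/-! ### The algebra of `mulTest` -/

theorem mulTest_apply (φ : Test n) (u : Distr n) (f : 𝓢(Space n, ℂ)) :
    mulTest φ u f = u (cut Complex.reCLM φ f) + Complex.I * u (cut Complex.imCLM φ f) := rfl

/-- `⟨φ u, f⟩` depends on the product `φ f` only. -/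
theorem mulTest_apply_congr {φ ψ : Test n} {f g : 𝓢(Space n, ℂ)} (u : Distr n)
    (h : ∀ x, φ x * f x = ψ x * g x) : mulTest φ u f = mulTest ψ u g := by
  have hc (c : ℂ →L[ℝ] ℝ) : cut c φ f = cut c ψ g := by
    ext x
    simp [h]
  rw [mulTest_apply, mulTest_apply, hc, hc]

theorem mulTest_eq_schwartzSmul {φ ψ : Test n} {f : 𝓢(Space n, ℂ)} (u : Distr n)
    (h : ∀ x, φ x = f x * ψ x) : mulTest φ u = schwartzSmul f (mulTest ψ u) := by
  ext g
  rw [schwartzSmul_apply]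
  refine mulTest_apply_congr u fun x => ?_
  rw [h, schwartzMul_apply]
  ring

theorem mulTest_sub (φ ψ : Test n) (u : Distr n) :
    mulTest (φ - ψ) u = mulTest φ u - mulTest ψ u := by
  ext f
  have hc (c : ℂ →L[ℝ] ℝ) : cut c (φ - ψ) f = cut c φ f - cut c ψ f := by
    ext x
    simp [sub_mul]
  change mulTest (φ - ψ) u f = mulTest φ u f - mulTest ψ u f
  rw [mulTest_apply, mulTest_apply, mulTest_apply, hc, hc, map_sub, map_sub]
  ring

theorem mulTest_add_right (φ : Test n) (u v : Distr n) :
    mulTest φ (u + v) = mulTest φ u + mulTest φ v := by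
  ext f
  change (u + v) (cut Complex.reCLM φ f) + Complex.I * (u + v) (cut Complex.imCLM φ f) =
    mulTest φ u f + mulTest φ v f
  rw [mulTest_apply, mulTest_apply]
  change (u _ + v _) + Complex.I * (u _ + v _) = _
  ring

theorem mulTest_smul_right (φ : Test n) (a : ℂ) (u : Distr n) :
    mulTest φ (a • u) = a • mulTest φ u := by
  ext f
  change a * u (cut Complex.reCLM φ f) + Complex.I * (a * u (cut Complex.imCLM φ f)) =
    a * mulTest φ u f
  rw [mulTest_apply]
  ring

theorem mulTest_zero_right (φ : Test n) : mulTest φ (0 : Distr n) = 0 := by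
  ext f
  change (0 : ℂ) + Complex.I * 0 = 0
  simp

/-! ### Real test functions as Schwartz functions -/

/-- A smooth real-valued function with support in `K`, as a complex-valued Schwartz function. -/
def complexifyLM (K : TopologicalSpace.Compacts (Space n)) :
    ContDiffMapSupportedIn (Space n) ℝ ⊤ K →ₗ[ℝ] 𝓢(Space n, ℂ) where
  toFun f := HasCompactSupport.toSchwartzMap (f := fun x => (f x : ℂ))
    (f.compact_supp.comp_left Complex.ofReal_zero) (Complex.ofRealCLM.contDiff.comp f.contDiff)
  map_add' f g := by
    ext x
    exact Complex.ofReal_add (f x) (g x)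
  map_smul' r f := by
    ext x
    change ((r * f x : ℝ) : ℂ) = r • ((f x : ℝ) : ℂ)
    simp

theorem continuous_complexifyLM (K : TopologicalSpace.Compacts (Space n)) :
    Continuous (complexifyLM K) := by
  obtain ⟨R, hR⟩ := K.isCompact.isBounded.exists_norm_le
  refine (schwartz_withSeminorms ℝ (Space n) ℂ).continuous_of_continuous_comp _ fun ki => ?_
  obtain ⟨k, i⟩ := ki
  let c : ℝ≥0 := R.toNNReal ^ k
  have hcont : Continuous (c • ContDiffMapSupportedIn.seminorm ℝ (Space n) ℝ ⊤ K i) :=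
    continuous_const.smul
      ((ContDiffMapSupportedIn.withSeminorms ℝ (Space n) ℝ ⊤ K).continuous_seminorm i)
  refine Seminorm.continuous_of_le hcont fun f => ?_
  refine SchwartzMap.seminorm_le_bound ℝ k i _ (apply_nonneg _ _) fun x => ?_
  have hnorm : ‖iteratedFDeriv ℝ i (complexifyLM K f) x‖ = ‖iteratedFDeriv ℝ i f x‖ :=
    LinearIsometry.norm_iteratedFDeriv_comp_left (f := f) Complex.ofRealLI
      (f.contDiff.contDiffAt (x := x)) (by exact_mod_cast le_top)
  rw [hnorm]
  by_cases hx : x ∈ (K : Set (Space n))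
  · change _ ≤ (c : ℝ) * ContDiffMapSupportedIn.seminorm ℝ (Space n) ℝ ⊤ K i f
    have h1 : ‖x‖ ≤ R.toNNReal := (hR x hx).trans (Real.le_coe_toNNReal R)
    have h2 := ContDiffMapSupportedIn.norm_iteratedFDeriv_apply_le_seminorm_top ℝ
      (i := i) (f := f) (x := x)
    simp only [c, NNReal.coe_pow]
    gcongr
  · have h1 : iteratedFDeriv ℝ i f x = 0 := by
      have h2 : x ∉ tsupport (iteratedFDeriv ℝ i f) := fun h => hx
        (f.tsupport_subset (tsupport_iteratedFDeriv_subset i h))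
      exact image_eq_zero_of_notMem_tsupport h2
    rw [h1, norm_zero, mul_zero]
    exact apply_nonneg _ _

/-- The real-linear embedding of smooth real-valued functions with support in `K` into the
Schwartz space. -/
def complexifyCLM (K : TopologicalSpace.Compacts (Space n)) :
    ContDiffMapSupportedIn (Space n) ℝ ⊤ K →L[ℝ] 𝓢(Space n, ℂ) :=
  ⟨complexifyLM K, continuous_complexifyLM K⟩

/-- A real-valued test function as a complex-valued Schwartz function. -/
def complexify (h : TestFunction (⊤ : TopologicalSpace.Opens (Space n)) ℝ ⊤) : 𝓢(Space n, ℂ) :=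
  HasCompactSupport.toSchwartzMap (f := fun x => (h x : ℂ))
    (h.hasCompactSupport.comp_left Complex.ofReal_zero) (Complex.ofRealCLM.contDiff.comp h.contDiff)

@[simp] theorem complexify_apply (h : TestFunction (⊤ : TopologicalSpace.Opens (Space n)) ℝ ⊤)
    (x : Space n) : complexify h x = (h x : ℂ) := rfl

/-- A distribution can be recovered from its products with test functions. -/
theorem mulTest_apply_complexify {φ : Test n} (w : Distr n)
    {h : TestFunction (⊤ : TopologicalSpace.Opens (Space n)) ℝ ⊤}
    (hφ : ∀ x, h x ≠ 0 → φ x = 1) : mulTest φ w (complexify h) = w h := by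
  have hx (x : Space n) : φ x * (h x : ℂ) = h x := by
    by_cases h0 : h x = 0
    · simp [h0]
    · rw [hφ x h0, one_mul]
  have h1 : cut Complex.reCLM φ (complexify h) = h := by
    ext x
    simp only [cut_apply, complexify_apply, hx]
    simp
  have h2 : cut Complex.imCLM φ (complexify h) = 0 := by
    ext x
    simp only [cut_apply, complexify_apply, hx]
    simp
  rw [mulTest_apply, h1, h2, map_zero, mul_zero, add_zero]

/-! ### Products of distributions that are locally in Sobolev spaces -/

/-- `u` is locally in `H^s`. -/
def LocH (s : Fin j → ℝ) (u : Distr n) : Prop := ∀ φ : Test n, MemH s (mulTest φ u)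

/-- A distribution is determined by its products with the squares of test functions. -/
theorem distr_ext {w w' : Distr n}
    (h : ∀ φ : Test n, mulTest (testMul φ φ) w = mulTest (testMul φ φ) w') : w = w' := by
  refine DFunLike.ext _ _ fun f => ?_
  obtain ⟨N, hN⟩ := exists_norm_le_of_hasCompactSupport f.hasCompactSupport
  have hφ (x : Space n) (hx : f x ≠ 0) : testMul (cutoff n N) (cutoff n N) x = 1 := by
    rw [testMul_apply, cutoff_eq_one (by linarith [hN x hx]), mul_one]
  rw [← mulTest_apply_complexify w hφ, ← mulTest_apply_complexify w' hφ, h]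

theorem IsProd.unique {s t : Fin j → ℝ} {u v w w' : Distr n} (h : IsProd s t u v w)
    (h' : IsProd s t u v w') : w = w' :=
  distr_ext fun φ => (h φ φ).unique (h' φ φ)

/-- The product of `φ u` and `ψ v`, evaluated at `f`, depends on `φ ψ f` only. -/
theorem IsProdH.apply_eq (hn : ∀ l, 0 < n l) {s t : Fin j → ℝ}
    (hex : ∀ S T : 𝓢'(Space n, ℂ), MemH s S → MemH t T → ∃ W, IsProdH s t S T W)
    {u v : Distr n} (hu : LocH s u) (hv : LocH t v) {φ ψ φ' ψ' : Test n} {W W' : 𝓢'(Space n, ℂ)}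
    (h : IsProdH s t (mulTest φ u) (mulTest ψ v) W)
    (h' : IsProdH s t (mulTest φ' u) (mulTest ψ' v) W') {f f' : 𝓢(Space n, ℂ)}
    (hff : ∀ x, φ x * ψ x * f x = φ' x * ψ' x * f' x) : W f = W' f' := by
  obtain ⟨N₁, h₁⟩ := exists_cutoff φ
  obtain ⟨N₂, h₂⟩ := exists_cutoff ψ
  obtain ⟨N₃, h₃⟩ := exists_cutoff φ'
  obtain ⟨N₄, h₄⟩ := exists_cutoff ψ'
  -- with `χ = 1` on all four supports, both products are multiples of that of `χ u` and `χ v`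
  let χ : Test n := cutoff n (N₁ + N₂ + N₃ + N₄)
  obtain ⟨V, hV⟩ := hex (mulTest χ u) (mulTest χ v) (hu χ) (hv χ)
  have key {φ ψ : Test n} (hφ : ∀ x, φ x * χ x = φ x) (hψ : ∀ x, ψ x * χ x = ψ x)
      {W : 𝓢'(Space n, ℂ)} (h : IsProdH s t (mulTest φ u) (mulTest ψ v) W) :
      W = schwartzSmul (schwartzMul (toSchwartz φ) (toSchwartz ψ)) V := by
    rw [mulTest_eq_schwartzSmul (ψ := χ) (f := toSchwartz φ) u fun x => (hφ x).symm,
      mulTest_eq_schwartzSmul (ψ := χ) (f := toSchwartz ψ) v fun x => (hψ x).symm] at h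
    exact hV.eq_schwartzSmul hn h
  rw [key (h₁ _ (by omega)) (h₂ _ (by omega)) h, key (h₃ _ (by omega)) (h₄ _ (by omega)) h',
    schwartzSmul_apply, schwartzSmul_apply]
  congr 1
  ext x
  simpa using hff x

/-- Local products glue to a distribution. -/
theorem exists_isProd (hn : ∀ l, 0 < n l) {s t : Fin j → ℝ}
    (hex : ∀ S T : 𝓢'(Space n, ℂ), MemH s S → MemH t T → ∃ W, IsProdH s t S T W)
    {u v : Distr n} (hu : LocH s u) (hv : LocH t v) : ∃ w, IsProd s t u v w := by
  choose W hW using fun N : ℕ => hex (mulTest (cutoff n N) u) (mulTest (cutoff n N) v) (hu _) (hv _)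
  have hcut {f : 𝓢(Space n, ℂ)} {N : ℕ} (hN : ∀ x, f x ≠ 0 → ‖x‖ ≤ N) (x : Space n) :
      cutoff n N x * cutoff n N x * f x = f x := by
    by_cases hx : f x = 0
    · simp [hx]
    · rw [cutoff_eq_one (by linarith [hN x hx]), one_mul, one_mul]
  have hWeq {f : 𝓢(Space n, ℂ)} {N M : ℕ} (hN : ∀ x, f x ≠ 0 → ‖x‖ ≤ N)
      (hM : ∀ x, f x ≠ 0 → ‖x‖ ≤ M) : W N f = W M f :=
    (hW N).apply_eq hn hex hu hv (hW M) fun x => by rw [hcut hN, hcut hM]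
  -- `⟨w, h⟩ = ⟨W N, h⟩` for any `N` such that `h` is supported in the ball of radius `N`
  choose R hR using fun h : TestFunction (⊤ : TopologicalSpace.Opens (Space n)) ℝ ⊤ =>
    exists_norm_le_of_hasCompactSupport h.hasCompactSupport
  have hRc (h) (x : Space n) (hx : complexify h x ≠ 0) : ‖x‖ ≤ R h :=
    hR h x fun h0 => hx (by simp [h0])
  have hK (K : TopologicalSpace.Compacts (Space n)) :
      ∃ N : ℕ, ∀ x ∈ (K : Set (Space n)), ‖x‖ ≤ N := by
    obtain ⟨r, hr⟩ := K.isCompact.isBounded.exists_norm_le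
    obtain ⟨N, hN⟩ := exists_nat_ge r
    exact ⟨N, fun x hx => (hr x hx).trans hN⟩
  choose Q hQ using hK
  let w : Distr n := TestFunction.limitCLM ℝ (fun h => W (R h) (complexify h))
    (fun K _ => ((W (Q K)).restrictScalars ℝ).comp (complexifyCLM K))
    (fun K hK f => by
      refine hWeq (f := complexify (TestFunction.ofSupportedIn hK f)) (hRc _) fun x hx => ?_
      refine hQ K x ?_
      by_contra hxK
      exact hx (by
        rw [complexify_apply]
        change ((f x : ℝ) : ℂ) = 0
        rw [f.zero_on_compl hxK]
        simp))
  have hw (h) : w h = W (R h) (complexify h) := rfl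
  refine ⟨w, fun φ ψ => ?_⟩
  obtain ⟨V, hV⟩ := hex (mulTest φ u) (mulTest ψ v) (hu φ) (hv ψ)
  suffices mulTest (testMul φ ψ) w = V by rwa [this]
  ext f
  obtain ⟨N, hN⟩ := exists_norm_le_of_hasCompactSupport φ.hasCompactSupport
  have hval (c : ℂ →L[ℝ] ℝ) :
      w (cut c (testMul φ ψ) f) = W N (complexify (cut c (testMul φ ψ) f)) := by
    rw [hw]
    refine hWeq (hRc _) fun x hx => hN x fun h0 => hx ?_
    simp [h0]
  rw [mulTest_apply, hval, hval, ← smul_eq_mul, ← map_smul, ← map_add]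
  refine (hW N).apply_eq hn hex hu hv hV fun x => ?_
  have h1 : (complexify (cut Complex.reCLM (testMul φ ψ) f) +
      Complex.I • complexify (cut Complex.imCLM (testMul φ ψ) f)) x = φ x * ψ x * f x := by
    simp only [add_apply, smul_apply, complexify_apply, cut_apply, testMul_apply, smul_eq_mul,
      Complex.reCLM_apply, Complex.imCLM_apply]
    rw [mul_comm Complex.I]
    exact Complex.re_add_im _
  rw [hcut (fun y hy => hN y fun h0 => hy ?_), h1]
  simp [h0]

/-! ### Continuity of the local norms -/

/-- The function `y ↦ ‖u τ_y χ‖_{H^s}`. -/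
abbrev localNorm (s : Fin j → ℝ) (χ : Test n) (u : Distr n) (y : Space n) : ℝ≥0∞ :=
  hNorm s (mulTest (translate y χ) u)

theorem LocH.localNorm_ne_top {s : Fin j → ℝ} {u : Distr n} (hu : LocH s u) (χ : Test n)
    (y : Space n) : localNorm s χ u y ≠ ⊤ := (memH_iff.1 (hu _)).ne

/-- If `u` is locally in `H^s`, the function `y ↦ ‖u τ_y χ‖_{H^s}` is continuous, since `y ↦ τ_y χ`
is continuous in a space of multipliers of `H^s`. -/
theorem LocH.continuous_localNorm (hn : ∀ l, 0 < n l) {s : Fin j → ℝ} {u : Distr n}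
    (hu : LocH s u) (χ : Test n) : Continuous (localNorm s χ u) := by
  obtain ⟨C, hC⟩ := exists_hNorm_schwartzSmul_le (n := n) hn s
  rw [continuous_iff_continuousAt]
  intro z
  obtain ⟨N, hN⟩ := exists_norm_le_of_hasCompactSupport χ.hasCompactSupport
  obtain ⟨M, hM⟩ := exists_nat_ge ‖z‖
  let φ := cutoff n (N + M + 1)
  -- `φ = 1` on the supports of `τ_y χ` for all `y` at distance less than `1` from `z`
  let e (y : Space n) : ℝ≥0∞ := C * hNorm (multOrder n s) (ofSchwartz (shift y (toSchwartz χ) -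
    shift z (toSchwartz χ))) * hNorm s (mulTest φ u)
  have he : Tendsto e (𝓝 z) (𝓝 0) := by
    have h1 := tendsto_hNorm_shift_sub (multOrder n s) z (toSchwartz χ)
    have h2 := ENNReal.Tendsto.mul_const (ENNReal.Tendsto.const_mul h1
      (Or.inr (ENNReal.coe_ne_top (r := C)))) (b := hNorm s (mulTest φ u))
      (Or.inr (memH_iff.1 (hu φ)).ne)
    simpa only [mul_zero, zero_mul] using h2
  have hcut {y : Space n} (hy : dist y z < 1) (x : Space n) :
      χ (x - y) * φ x = χ (x - y) := by
    by_cases hx : χ (x - y) = 0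
    · simp [hx]
    · have h1 := hN _ hx
      have h2 : ‖x‖ ≤ ‖x - y‖ + ‖y - z‖ + ‖z‖ := by
        calc ‖x‖ = ‖(x - y) + (y - z) + z‖ := by congr 1; abel
          _ ≤ _ := norm_add₃_le
      rw [dist_eq_norm] at hy
      rw [cutoff_eq_one (by push_cast; linarith), mul_one]
  have hsub {y : Space n} (hy : dist y z < 1) :
      hNorm s (mulTest (translate y χ) u - mulTest (translate z χ) u) ≤ e y := by
    rw [← mulTest_sub, mulTest_eq_schwartzSmul (ψ := φ)
      (f := shift y (toSchwartz χ) - shift z (toSchwartz χ)) u fun x => ?_]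
    · exact hC _ _ (hu φ)
    · change χ (x - y) - χ (x - z) = (χ (x - y) - χ (x - z)) * φ x
      rw [sub_mul, hcut hy, hcut (by simp)]
  have hball : ∀ᶠ y in 𝓝 z, dist y z < 1 := Metric.ball_mem_nhds z one_pos
  have hlow : Tendsto (fun y => localNorm s χ u z - e y) (𝓝 z) (𝓝 (localNorm s χ u z)) := by
    simpa using ENNReal.Tendsto.sub tendsto_const_nhds he (Or.inl (hu.localNorm_ne_top χ z))
  have hupp : Tendsto (fun y => localNorm s χ u z + e y) (𝓝 z) (𝓝 (localNorm s χ u z)) := by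
    simpa using tendsto_const_nhds.add he
  refine tendsto_of_tendsto_of_tendsto_of_le_of_le' hlow hupp ?_ ?_
  · filter_upwards [hball] with y hy
    rw [tsub_le_iff_right]
    have h1 := hNorm_add_le s (mulTest (translate y χ) u)
      (mulTest (translate z χ) u - mulTest (translate y χ) u)
    rw [add_sub_cancel, hNorm_sub_comm] at h1
    exact h1.trans (add_le_add le_rfl (hsub hy))
  · filter_upwards [hball] with y hy
    have h1 := hNorm_add_le s (mulTest (translate z χ) u)
      (mulTest (translate y χ) u - mulTest (translate z χ) u)
    rw [add_sub_cancel] at h1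
    exact h1.trans (add_le_add le_rfl (hsub hy))

theorem LocH.aestronglyMeasurable_localNorm (hn : ∀ l, 0 < n l) {s : Fin j → ℝ} {u : Distr n}
    (hu : LocH s u) (χ : Test n) : AEStronglyMeasurable (localNorm s χ u) volume :=
  (hu.continuous_localNorm hn χ).measurable.aestronglyMeasurable

/-! ### Independence of the localizing function -/

/-- Every test function is a finite sum of multiples of translates of a given one. -/
theorem exists_eq_sum_translate {χ₀ : Test n} (hχ₀ : χ₀ ≠ 0) (χ : Test n) :
    ∃ (A : Finset (Space n)) (θ : Space n → Test n),
      ∀ x, χ x = ∑ a ∈ A, θ a x * χ₀ (x - a) := by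
  obtain ⟨x₀, hx₀⟩ : ∃ x₀, χ₀ x₀ ≠ 0 := by
    by_contra! h
    exact hχ₀ (TestFunction.ext h)
  have hcont (a : Space n) : Continuous fun x => χ₀ (x - a) := χ₀.continuous.comp (by fun_prop)
  obtain ⟨B, -, hB⟩ := χ.hasCompactSupport.isCompact.elim_nhds_subcover
    (fun x => {y | χ₀ (y - (x - x₀)) ≠ 0}) fun x _ =>
      (isOpen_ne_fun (hcont _) continuous_const).mem_nhds (by simpa using hx₀)
  classical
  -- `θ_a = χ conj(τ_a χ₀) / Φ`, where `Φ = ∑ |τ_a χ₀|²` has no zeros on the support of `χ`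
  let A := B.image fun x => x - x₀
  let Φ (x : Space n) : ℂ := ∑ a ∈ A, (starRingEnd ℂ) (χ₀ (x - a)) * χ₀ (x - a)
  have hΦ (x : Space n) (hx : x ∈ tsupport χ) : Φ x ≠ 0 := by
    have h1 : Φ x = ((∑ a ∈ A, Complex.normSq (χ₀ (x - a)) : ℝ) : ℂ) := by
      simp only [Φ, Complex.ofReal_sum, Complex.normSq_eq_conj_mul_self]
    obtain ⟨b, hb, hxb⟩ := Set.mem_iUnion₂.1 (hB hx)
    have h2 : 0 < ∑ a ∈ A, Complex.normSq (χ₀ (x - a)) :=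
      Finset.sum_pos' (fun a _ => Complex.normSq_nonneg _)
        ⟨b - x₀, Finset.mem_image_of_mem _ hb, Complex.normSq_pos.2 hxb⟩
    rw [h1]
    exact_mod_cast h2.ne'
  have hshift (a : Space n) : ContDiff ℝ ((⊤ : ℕ∞) : WithTop ℕ∞) fun x => χ₀ (x - a) :=
    χ₀.contDiff.comp (contDiff_id.sub contDiff_const)
  have hconj (a : Space n) :
      ContDiff ℝ ((⊤ : ℕ∞) : WithTop ℕ∞) fun x => (starRingEnd ℂ) (χ₀ (x - a)) :=
    Complex.conjCLE.contDiff.comp (hshift a)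
  have hΦs : ContDiff ℝ ((⊤ : ℕ∞) : WithTop ℕ∞) Φ :=
    ContDiff.sum fun a _ => (hconj a).mul (hshift a)
  let θ (a : Space n) : Test n :=
    { toFun := fun x => χ x * ((starRingEnd ℂ) (χ₀ (x - a)) * (Φ x)⁻¹)
      contDiff' := by
        rw [contDiff_iff_contDiffAt]
        intro x
        by_cases hx : x ∈ tsupport χ
        · exact χ.contDiff.contDiffAt.mul
            ((hconj a).contDiffAt.mul (hΦs.contDiffAt.inv (hΦ x hx)))
        · have h1 : (fun x => χ x * ((starRingEnd ℂ) (χ₀ (x - a)) * (Φ x)⁻¹)) =ᶠ[𝓝 x]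
              fun _ => 0 := by
            filter_upwards [notMem_tsupport_iff_eventuallyEq.1 hx] with y hy
            simp [hy]
          exact contDiffAt_const.congr_of_eventuallyEq h1
      hasCompactSupport' := χ.hasCompactSupport.mul_right
      tsupport_subset' := fun _ _ => trivial }
  refine ⟨A, θ, fun x => ?_⟩
  have h1 (a : Space n) : θ a x * χ₀ (x - a) =
      χ x * ((starRingEnd ℂ) (χ₀ (x - a)) * χ₀ (x - a) / Φ x) := by
    change χ x * ((starRingEnd ℂ) (χ₀ (x - a)) * (Φ x)⁻¹) * χ₀ (x - a) = _
    ring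
  simp only [h1]
  rw [← Finset.mul_sum, ← Finset.sum_div]
  change χ x = χ x * (Φ x / Φ x)
  by_cases hx : χ x = 0
  · simp [hx]
  · rw [div_self (hΦ x (subset_tsupport _ hx)), mul_one]

theorem mulTest_translate_eq_sum {χ χ₀ : Test n} {A : Finset (Space n)} {θ : Space n → Test n}
    (h : ∀ x, χ x = ∑ a ∈ A, θ a x * χ₀ (x - a)) (u : Distr n) (y : Space n) :
    mulTest (translate y χ) u =
      ∑ a ∈ A, schwartzSmul (shift y (toSchwartz (θ a))) (mulTest (translate (y + a) χ₀) u) := by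
  have h1 (a : Space n) : schwartzSmul (shift y (toSchwartz (θ a)))
      (mulTest (translate (y + a) χ₀) u) =
      mulTest (testMul (translate y (θ a)) (translate (y + a) χ₀)) u :=
    (mulTest_eq_schwartzSmul u fun x => rfl).symm
  simp only [h1]
  ext f
  have h2 (c : ℂ →L[ℝ] ℝ) : cut c (translate y χ) f =
      ∑ a ∈ A, cut c (testMul (translate y (θ a)) (translate (y + a) χ₀)) f := by
    ext x
    rw [_root_.sum_apply]
    simp only [cut_apply, translate_apply, testMul_apply, h, Finset.sum_mul, map_sum, sub_sub]
  have h3 : (∑ a ∈ A, mulTest (testMul (translate y (θ a)) (translate (y + a) χ₀)) u) f =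
      ∑ a ∈ A, mulTest (testMul (translate y (θ a)) (translate (y + a) χ₀)) u f := by
    exact map_sum (PointwiseConvergenceCLM.evalCLM (RingHom.id ℂ) ℂ f) _ _
  rw [h3]
  simp only [mulTest_apply]
  rw [h2, h2, map_sum, map_sum, Finset.mul_sum, Finset.sum_add_distrib]

/-- The local norm with respect to `χ` is controlled by finitely many translates of the local norm
with respect to `χ₀`. -/
theorem exists_localNorm_le_sum (hn : ∀ l, 0 < n l) (s : Fin j → ℝ) {χ₀ : Test n} (hχ₀ : χ₀ ≠ 0)
    (χ : Test n) : ∃ (A : Finset (Space n)) (K : Space n → ℝ≥0), ∀ u : Distr n,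
      (∀ y, MemH s (mulTest (translate y χ₀) u)) →
      ∀ y, localNorm s χ u y ≤ ∑ a ∈ A, K a * localNorm s χ₀ u (y + a) := by
  obtain ⟨A, θ, hθ⟩ := exists_eq_sum_translate hχ₀ χ
  obtain ⟨C, hC⟩ := exists_hNorm_schwartzSmul_le (n := n) hn s
  refine ⟨A, fun a => C * (hNorm (multOrder n s) (ofSchwartz (toSchwartz (θ a)))).toNNReal,
    fun u hu y => ?_⟩
  rw [localNorm, mulTest_translate_eq_sum hθ]
  refine (hNorm_sum_le _ _ _).trans (Finset.sum_le_sum fun a _ => (hC _ _ (hu _)).trans ?_)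
  rw [hNorm_shift, ENNReal.coe_mul, ENNReal.coe_toNNReal (memH_iff.1 (memH_ofSchwartz _ _)).ne]

theorem MemK.locH (hn : ∀ l, 0 < n l) {p : ℝ≥0∞} {s : Fin j → ℝ} {u : Distr n}
    (hu : MemK p s u) : LocH s u := by
  obtain ⟨χ₀, hχ₀, hmem, -⟩ := hu
  intro χ
  obtain ⟨A, K, hK⟩ := exists_localNorm_le_sum hn s hχ₀ χ
  have h1 := hK u hmem 0
  have h2 : translate 0 χ = χ := by
    ext x
    simp
  rw [localNorm, h2] at h1
  refine memH_iff.2 (h1.trans_lt (ENNReal.sum_lt_top.2 fun a _ => ?_))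
  exact ENNReal.mul_lt_top ENNReal.coe_lt_top (memH_iff.1 (hmem _))

/-- Membership in `K_p^s` does not depend on the localizing function. -/
theorem MemK.memLp (hn : ∀ l, 0 < n l) {p : ℝ≥0∞} {s : Fin j → ℝ} {u : Distr n}
    (hu : MemK p s u) (χ : Test n) : MemLp (localNorm s χ u) p volume := by
  have hloc := hu.locH hn
  obtain ⟨χ₀, hχ₀, hmem, hLp⟩ := hu
  obtain ⟨A, K, hK⟩ := exists_localNorm_le_sum hn s hχ₀ χ
  have h1 : MemLp (fun y => ∑ a ∈ A, K a * localNorm s χ₀ u (y + a)) p volume := by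
    refine memLp_finsetSum _ fun a _ => ?_
    have h2 : MemLp (fun y => localNorm s χ₀ u (y + a)) p volume :=
      hLp.comp_measurePreserving (measurePreserving_add_right volume a)
    refine h2.of_le_mul' (c := K a) ?_ (ae_of_all _ fun y => le_rfl)
    have h3 := (hloc.continuous_localNorm hn χ₀).comp (continuous_add_const a)
    exact (h3.measurable.const_mul _).aestronglyMeasurable
  exact h1.of_le_enorm (hloc.aestronglyMeasurable_localNorm hn χ) (ae_of_all _ (hK u hmem))

/-! ### The inclusion `K_p^s ⊆ K_∞^s` -/

/-- A local norm at `y` is bounded by local norms at all nearby points, hence by their average. -/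
theorem MemK.top (hn : ∀ l, 0 < n l) {p : ℝ≥0∞} (hp : 1 ≤ p) {s : Fin j → ℝ} {u : Distr n}
    (hu : MemK p s u) : MemK ⊤ s u := by
  have hloc := hu.locH hn
  obtain ⟨C, hC⟩ := exists_hNorm_schwartzSmul_le (n := n) hn s
  let χ₁ : Test n := cutoff n 0
  let χ₂ : Test n := cutoff n 2
  have hχ (x z : Space n) (hz : ‖z‖ ≤ 1) : χ₁ x = χ₁ x * χ₂ (x - z) := by
    by_cases hx : χ₁ x = 0
    · simp [hx]
    · have h1 : ‖x‖ < 2 := by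
        by_contra! h
        exact hx (cutoff_eq_zero (by simpa using h))
      have h2 : χ₂ (x - z) = 1 := cutoff_eq_one (by
        have := norm_sub_le x z
        push_cast
        linarith)
      rw [h2, mul_one]
  let K : ℝ≥0∞ := C * hNorm (multOrder n s) (ofSchwartz (toSchwartz χ₁))
  have hK : K ≠ ⊤ := ENNReal.mul_ne_top ENNReal.coe_ne_top (memH_iff.1 (memH_ofSchwartz _ _)).ne
  have hle (y z : Space n) (hz : ‖z‖ ≤ 1) :
      localNorm s χ₁ u y ≤ K * localNorm s χ₂ u (y + z) := by
    rw [localNorm, mulTest_eq_schwartzSmul (ψ := translate (y + z) χ₂)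
      (f := shift y (toSchwartz χ₁)) u fun x => ?_]
    · refine (hC _ _ (hloc _)).trans ?_
      rw [hNorm_shift]
    · change χ₁ (x - y) = χ₁ (x - y) * χ₂ (x - (y + z))
      rw [← sub_sub]
      exact hχ _ z hz
  have hLp := hu.memLp hn χ₂
  have hp0 : p ≠ 0 := (one_pos.trans_le hp).ne'
  let μ : Measure (Space n) := volume.restrict (Metric.ball 0 1)
  have hμ : μ Set.univ ≠ 0 := by
    simpa [μ] using (Metric.measure_ball_pos volume (0 : Space n) one_pos).ne'
  have hμ' : μ Set.univ ≠ ⊤ := by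
    simpa [μ] using (measure_ball_lt_top (μ := volume) (x := (0 : Space n)) (r := 1)).ne
  have hμ0 : μ ≠ 0 := fun h => hμ (by rw [h]; simp)
  let V : ℝ≥0∞ := μ Set.univ ^ (1 / p.toReal)
  have hV0 : V ≠ 0 := by
    simp only [V, ne_eq, ENNReal.rpow_eq_zero_iff, not_or, not_and]
    exact ⟨fun h => (hμ h).elim, fun h => (hμ' h).elim⟩
  have hbound (y : Space n) : localNorm s χ₁ u y ≤ K * eLpNorm (localNorm s χ₂ u) p volume / V := by
    have hVt : V ≠ ⊤ := ENNReal.rpow_ne_top_of_nonneg (by positivity) hμ'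
    rw [ENNReal.le_div_iff_mul_le (Or.inl hV0) (Or.inl hVt)]
    have htrans : eLpNorm (fun z => localNorm s χ₂ u (y + z)) p volume =
        eLpNorm (localNorm s χ₂ u) p volume :=
      eLpNorm_comp_measurePreserving (f := fun z => y + z) (g := localNorm s χ₂ u) hLp.1
        (measurePreserving_add_left volume y)
    calc localNorm s χ₁ u y * V = eLpNorm (fun _ : Space n => localNorm s χ₁ u y) p μ := by
          rw [eLpNorm_const _ hp0 hμ0, enorm_eq_self]
      _ ≤ K.toNNReal * eLpNorm (fun z => localNorm s χ₂ u (y + z)) p μ := by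
          refine eLpNorm_le_nnreal_smul_eLpNorm_of_ae_le_mul' ?_ p
          refine (ae_restrict_mem measurableSet_ball).mono fun z hz => ?_
          rw [enorm_eq_self, enorm_eq_self, ENNReal.coe_toNNReal hK]
          exact hle y z (by simpa using (mem_ball_zero_iff.1 hz).le)
      _ ≤ K * eLpNorm (fun z => localNorm s χ₂ u (y + z)) p volume := by
          rw [ENNReal.coe_toNNReal hK]
          gcongr
          exact Measure.restrict_le_self
      _ = K * eLpNorm (localNorm s χ₂ u) p volume := by rw [htrans]
  refine ⟨χ₁, cutoff_ne_zero 0, fun y => hloc _, hloc.aestronglyMeasurable_localNorm hn χ₁, ?_⟩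
  rw [eLpNorm_exponent_top]
  refine (eLpNormEssSup_le_of_ae_enorm_bound (ae_of_all _ fun y => ?_)).trans_lt
    (ENNReal.div_lt_top (ENNReal.mul_ne_top hK hLp.2.ne) hV0)
  rw [enorm_eq_self]
  exact hbound y

/-! ### Hölder's inequality for the local norms -/

/-- The norm for `p = ∞` is a supremum, whereas membership in `L^∞` concerns the essential supremum;
for continuous functions they agree. -/
theorem essSup_eq_iSup_of_continuous {f : Space n → ℝ≥0∞} (hf : Continuous f) :
    eLpNormEssSup f volume = ⨆ y, f y := by
  refine le_antisymm (eLpNormEssSup_le_of_ae_enorm_bound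
    (ae_of_all _ fun y => (enorm_eq_self (f y)).trans_le (le_iSup f y))) (iSup_le fun y => ?_)
  by_contra! hy
  have hopen : IsOpen {x | eLpNormEssSup f volume < f x} := isOpen_lt continuous_const hf
  have hzero : volume {x | eLpNormEssSup f volume < f x} = 0 := by
    have h := enorm_ae_le_eLpNormEssSup f volume
    simp only [enorm_eq_self] at h
    simpa [ae_iff] using h
  have := (hopen.measure_eq_zero_iff volume).1 hzero
  exact this.le hy

theorem kNorm_eq_eLpNorm (hn : ∀ l, 0 < n l) {p : ℝ≥0∞} (hp : 1 ≤ p) {s : Fin j → ℝ} {u : Distr n}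
    (hu : LocH s u) (χ : Test n) : kNorm p s χ u = eLpNorm (localNorm s χ u) p volume := by
  rw [kNorm]
  split_ifs with h
  · rw [h, eLpNorm_exponent_top, essSup_eq_iSup_of_continuous (hu.continuous_localNorm hn χ)]
  · rw [eLpNorm_eq_lintegral_rpow_enorm_toReal (one_pos.trans_le hp).ne' h]
    simp only [enorm_eq_self]

/-- Hölder's inequality for functions with finite values in `[0, ∞]`. -/
theorem eLpNorm_le_of_le_mul {α : Type*} [MeasurableSpace α] {μ : Measure α} {p q r : ℝ≥0∞}
    (hpqr : p⁻¹ + q⁻¹ = r⁻¹) {f g h : α → ℝ≥0∞} (hf : AEMeasurable f μ) (hg : AEMeasurable g μ)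
    (hft : ∀ x, f x ≠ ⊤) (hgt : ∀ x, g x ≠ ⊤) {C : ℝ≥0} (hle : ∀ x, h x ≤ C * f x * g x) :
    eLpNorm h r μ ≤ C * eLpNorm f p μ * eLpNorm g q μ := by
  have : ENNReal.HolderTriple p q r := ⟨hpqr⟩
  have hreal {f : α → ℝ≥0∞} (hft : ∀ x, f x ≠ ⊤) (p : ℝ≥0∞) :
      eLpNorm (fun x => (f x).toReal) p μ = eLpNorm f p μ := by
    refine eLpNorm_congr_enorm_ae (ae_of_all _ fun x => ?_)
    rw [enorm_eq_self, Real.enorm_of_nonneg ENNReal.toReal_nonneg, ENNReal.ofReal_toReal (hft x)]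
  have key := eLpNorm_le_eLpNorm_mul_eLpNorm_of_nnnorm (p := p) (q := q) (r := r) (μ := μ)
    (f := fun x => (f x).toReal) (g := fun x => (g x).toReal)
    hf.ennreal_toReal.aestronglyMeasurable hg.ennreal_toReal.aestronglyMeasurable
    (fun a b => (C : ℝ) * (a * b)) C (ae_of_all _ fun x => by simp [mul_assoc])
  rw [hreal hft, hreal hgt] at key
  refine (eLpNorm_mono_enorm fun x => ?_).trans key
  rw [enorm_eq_self, enorm_mul, enorm_mul, Real.enorm_of_nonneg ENNReal.toReal_nonneg,
    Real.enorm_of_nonneg ENNReal.toReal_nonneg, ENNReal.ofReal_toReal (hft x),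
    ENNReal.ofReal_toReal (hgt x), Real.enorm_of_nonneg C.coe_nonneg, ENNReal.ofReal_coe_nnreal,
    ← mul_assoc]
  exact hle x

theorem testMul_self_ne_zero {χ : Test n} (hχ : χ ≠ 0) : testMul χ χ ≠ 0 := by
  intro h
  refine hχ (TestFunction.ext fun x => ?_)
  have h1 : testMul χ χ x = 0 := by rw [h]; rfl
  simpa using h1

/-- The product theorem for Kato-Sobolev spaces. -/
theorem exists_product (hn : ∀ l, 0 < n l) {s t ε σ : Fin j → ℝ}
    (hε : ∀ l, 0 < ε l ∧ ε l < s l + t l - (n l : ℝ) / 2)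
    (hσ : ∀ l, σ l = min (s l) (min (t l) (s l + t l - (n l : ℝ) / 2 - ε l))) :
    ∃ C : ℝ≥0, ∀ p q r : ℝ≥0∞, 1 ≤ p → 1 ≤ q → 1 ≤ r → p⁻¹ + q⁻¹ = r⁻¹ →
      ∀ u v : Distr n, MemK p s u → MemK q t v →
        (∃! w, IsProd s t u v w) ∧
        ∀ w, IsProd s t u v w → MemK r σ w ∧
          ∀ χ : Test n, χ ≠ 0 → kNorm r σ (testMul χ χ) w ≤ C * kNorm p s χ u * kNorm q t χ v := by
  obtain ⟨C, hex, hC⟩ := exists_isProdH (n := n) hn hε hσ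
  refine ⟨C, fun p q r hp hq hr hpqr u v hu hv => ?_⟩
  have hul := hu.locH hn
  have hvl := hv.locH hn
  obtain ⟨w₀, hw₀⟩ := exists_isProd hn hex hul hvl
  refine ⟨⟨w₀, hw₀, fun w hw => hw.unique hw₀⟩, fun w hw => ?_⟩
  -- write `φ` as the product of itself and a cutoff function
  have hwl : LocH σ w := fun φ => by
    obtain ⟨N, hN⟩ := exists_cutoff φ
    have h1 : φ = testMul φ (cutoff n N) := by
      ext x
      exact (hN N le_rfl x).symm
    rw [h1]
    refine memH_iff.2 ((hC _ _ _ (hw φ (cutoff n N))).trans_lt ?_)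
    exact ENNReal.mul_lt_top (ENNReal.mul_lt_top ENNReal.coe_lt_top (memH_iff.1 (hul _)))
      (memH_iff.1 (hvl _))
  have hnorm (χ : Test n) : eLpNorm (localNorm σ (testMul χ χ) w) r volume ≤
      C * eLpNorm (localNorm s χ u) p volume * eLpNorm (localNorm t χ v) q volume :=
    eLpNorm_le_of_le_mul hpqr (hul.continuous_localNorm hn χ).aemeasurable
      (hvl.continuous_localNorm hn χ).aemeasurable (hul.localNorm_ne_top χ)
      (hvl.localNorm_ne_top χ) fun y => hC _ _ _ (hw (translate y χ) (translate y χ))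
  refine ⟨⟨testMul (cutoff n 0) (cutoff n 0), testMul_self_ne_zero (cutoff_ne_zero 0),
    fun y => hwl _, hwl.aestronglyMeasurable_localNorm hn _, (hnorm _).trans_lt ?_⟩,
    fun χ _ => ?_⟩
  · exact ENNReal.mul_lt_top (ENNReal.mul_lt_top ENNReal.coe_lt_top (hu.memLp hn _).2)
      (hv.memLp hn _).2
  · rw [kNorm_eq_eLpNorm hn hr hwl, kNorm_eq_eLpNorm hn hp hul, kNorm_eq_eLpNorm hn hq hvl]
    exact hnorm χ

/-- The Kato-Sobolev space `K_p^s` as a linear subspace of the space of distributions. -/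
def kSubmodule (hn : ∀ l, 0 < n l) (p : ℝ≥0∞) (s : Fin j → ℝ) : Submodule ℂ (Distr n) where
  carrier := {u | MemK p s u}
  zero_mem' := by
    refine ⟨cutoff n 0, cutoff_ne_zero 0, fun y => ?_, ?_⟩
    · rw [mulTest_zero_right]
      exact memH_iff.2 (by simp [hNorm_zero])
    · simp only [mulTest_zero_right, hNorm_zero]
      exact MemLp.zero'
  add_mem' {u v} hu hv := by
    have hloc : LocH s (u + v) := fun φ => by
      rw [mulTest_add_right]
      exact memH_iff.2 ((hNorm_add_le _ _ _).trans_lt (ENNReal.add_lt_top.2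
        ⟨memH_iff.1 (hu.locH hn φ), memH_iff.1 (hv.locH hn φ)⟩))
    refine ⟨cutoff n 0, cutoff_ne_zero 0, fun y => hloc _, ?_⟩
    refine ((hu.memLp hn (cutoff n 0)).add (hv.memLp hn (cutoff n 0))).of_le_enorm
      (hloc.aestronglyMeasurable_localNorm hn _) (ae_of_all _ fun y => ?_)
    rw [enorm_eq_self, enorm_eq_self, mulTest_add_right]
    exact hNorm_add_le _ _ _
  smul_mem' a u hu := by
    have hloc : LocH s (a • u) := fun φ => by
      rw [mulTest_smul_right]
      exact memH_iff.2 ((hNorm_smul_le _ _ _).trans_lt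
        (ENNReal.mul_lt_top enorm_lt_top (memH_iff.1 (hu.locH hn φ))))
    refine ⟨cutoff n 0, cutoff_ne_zero 0, fun y => hloc _, ?_⟩
    refine (hu.memLp hn (cutoff n 0)).of_le_mul' (c := ‖a‖₊)
      (hloc.aestronglyMeasurable_localNorm hn _) (ae_of_all _ fun y => ?_)
    rw [enorm_eq_self, enorm_eq_self, mulTest_smul_right]
    exact hNorm_smul_le _ _ _

end KatoSobolev

end

theorem proposition3p8 (j : ℕ) (hj : 0 < j) (n : Fin j → ℕ) (hn : ∀ l, 0 < n l) :
    -- products of Kato-Sobolev spaces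
    (∀ s t ε σ : Fin j → ℝ,
      (∀ l, (n l : ℝ) / 2 < s l + t l) →
      (∀ l, 0 < ε l ∧ ε l < s l + t l - (n l : ℝ) / 2) →
      (∀ l, σ l = min (s l) (min (t l) (s l + t l - (n l : ℝ) / 2 - ε l))) →
      ∃ C : ℝ≥0, ∀ p q r : ℝ≥0∞, 1 ≤ p → 1 ≤ q → 1 ≤ r → p⁻¹ + q⁻¹ = r⁻¹ →
        ∀ u v : KatoSobolev.Distr n, KatoSobolev.MemK p s u → KatoSobolev.MemK q t v →
          (∃! w, KatoSobolev.IsProd s t u v w) ∧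
          ∀ w, KatoSobolev.IsProd s t u v w →
            KatoSobolev.MemK r σ w ∧
            ∀ χ : KatoSobolev.Test n, χ ≠ 0 →
              KatoSobolev.kNorm r σ (KatoSobolev.testMul χ χ) w ≤
                C * KatoSobolev.kNorm p s χ u * KatoSobolev.kNorm q t χ v) ∧
    -- the ideal property
    (∀ s : Fin j → ℝ, (∀ l, (n l : ℝ) / 2 < s l) →
      ∀ p : ℝ≥0∞, 1 ≤ p →
        (∃ V : Submodule ℂ (KatoSobolev.Distr n), ∀ u, u ∈ V ↔ KatoSobolev.MemK p s u) ∧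
        (∀ u : KatoSobolev.Distr n, KatoSobolev.MemK p s u → KatoSobolev.MemK ⊤ s u) ∧
        ∀ u v : KatoSobolev.Distr n, KatoSobolev.MemK ⊤ s u → KatoSobolev.MemK p s v →
          (∃! w, KatoSobolev.IsProd s s u v w) ∧
          ∀ w, KatoSobolev.IsProd s s u v w → KatoSobolev.MemK p s w) := by

  refine ⟨fun s t ε σ _ hε hσ => KatoSobolev.exists_product hn hε hσ, fun s hs p hp => ?_⟩
  refine ⟨⟨KatoSobolev.kSubmodule hn p s, fun u => Iff.rfl⟩, fun u hu => hu.top hn hp,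
    fun u v hu hv => ?_⟩
  -- with `t = s` and `ε = s - n / 2`, the order of the product is `σ = s`
  obtain ⟨C, hC⟩ := KatoSobolev.exists_product (n := n) hn (s := s) (t := s)
    (ε := fun l => s l - (n l : ℝ) / 2) (σ := s)
    (fun l => by
      have h1 := hs l
      have h2 : (0 : ℝ) < n l := by exact_mod_cast hn l
      constructor <;> linarith)
    (fun l => by
      have h1 : s l + s l - (n l : ℝ) / 2 - (s l - (n l : ℝ) / 2) = s l := by ring
      rw [h1, min_self, min_self])
  obtain ⟨hw, hmem⟩ := hC ⊤ p p le_top hp hp (by simp) u v hu hv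
  exact ⟨hw, fun w h => (hmem w h).1⟩
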